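/- **Proposition 3.4.** Let $n\ge 2$, $k\ge 0$, let $G\subset SO(n)$ be a closed subgroup acting transitively on the unit sphere $S^{n-1}\subset\mathbb{R}^n$, and let $G$ act on $\mathbb{R}^{n+k}=\mathbb{R}^n\times\mathbb{R}^k$ by $g\cdot(x,y)=(gx,y)$. Let $\pi$ be a (continuous) unitary representation of $G$ on a finite-dimensional complex inner product space $V$, and let $$H^1_\pi(\mathbb{R}^{n+k})=\{u\in H^1(\mathbb{R}^{n+k},V) : u(gz)=\pi(g)u(z)\ \text{for all } g\in G \text{ and a.e. } z\}.$$ Let $\lambda>0$, $\beta>0$ and $1<p<\frac{n+k+2}{n+k-2}$ (meaning $1<p<\infty$ if $n+k=2$), and put $$F_\lambda(u)=\|\nabla u\|_{L^2}^2+\lambda\|u\|_{L^2}^2,\qquad J_p(u)=\int_{\mathbb{R}^{n+k}}|u|^{p+1}\,dz,$$ $$\mathcal I(\beta,\pi)=\inf\{F_\lambda(u): u\in H^1_\pi(\mathbb{R}^{n+k}),\ J_p(u)=\beta\}.$$ Let $(u_\nu)$ be a sequence in $H^1_\pi(\mathbb{R}^{n+k})$ with $J_p(u_\nu)=\beta$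 for all $\nu$ and $F_\lambda(u_\nu)\to\mathcal I(\beta,\pi)$. Then there exist a subsequence $(u_{s(\nu)})$, translations $y_\nu\in\mathbb{R}^k$ and $u\in H^1_\pi(\mathbb{R}^{n+k})$ such that $$u_{s(\nu)}(\,\cdot\,,\,\cdot+y_\nu)\to u\quad\text{in } L^{p+1}(\mathbb{R}^{n+k})\text{-norm and in } H^1\text{-norm},$$ and $J_p(u)=\beta$, $F_\lambda(u)=\mathcal I(\beta,\pi)$; that is, $u$ is an $F_\lambda$-minimizer subject to the constraint $J_p=\beta$. -/

import Mathlib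

open MeasureTheory Filter Topology
open scoped ENNReal ContDiff

noncomputable section

namespace AxialVortex

/-- The Euclidean space `ℝ^{n+k} = ℝ^n × ℝ^k`, with its Euclidean norm and Lebesgue measure. -/
abbrev Space (n k : ℕ) : Type := EuclideanSpace ℝ (Fin n ⊕ Fin k)

/-- The action of an `n × n` matrix on `ℝ^{n+k}` through the block matrix `diag(A, I)`. -/
def act {n : ℕ} (k : ℕ) (A : Matrix (Fin n) (Fin n) ℝ) (z : Space n k) : Space n k :=
  WithLp.toLp 2 ((Matrix.fromBlocks A 0 0 (1 : Matrix (Fin k) (Fin k) ℝ)).mulVec (WithLp.ofLp z))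

/-- `G` acts transitively on the unit sphere of `ℝ^n`. -/
def TransitiveOnSphere {n : ℕ} (G : Subgroup (Matrix.specialOrthogonalGroup (Fin n) ℝ)) : Prop :=
  ∀ x y : EuclideanSpace ℝ (Fin n), ‖x‖ = 1 → ‖y‖ = 1 →
    ∃ g ∈ G, WithLp.toLp 2 ((g : Matrix (Fin n) (Fin n) ℝ).mulVec (WithLp.ofLp x)) = y

/-- The point `(0, y)` of `ℝ^n × ℝ^k`. -/
def inY (n : ℕ) {k : ℕ} (y : EuclideanSpace ℝ (Fin k)) : Space n k :=
  WithLp.toLp 2 (Sum.elim 0 (WithLp.ofLp y))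

/-- The `ℝ^k`-translate `(x, y') ↦ u (x, y' + y)` of `u`. -/
def translateY {n k : ℕ} {V : Type*} (y : EuclideanSpace ℝ (Fin k)) (u : Space n k → V) :
    Space n k → V :=
  fun z => u (z + inY n y)

section Sobolev

variable {ι : Type*} [Fintype ι] [DecidableEq ι]
variable {V : Type*} [NormedAddCommGroup V] [InnerProductSpace ℂ V]

/-- `w` is the weak `j`-th partial derivative of `u` on `ℝ^ι` (tested against `C_c^∞` functions). -/
def IsWeakPartial (j : ι) (u w : EuclideanSpace ℝ ι → V) : Prop :=
  ∀ φ : EuclideanSpace ℝ ι → ℝ, ContDiff ℝ ∞ φ → HasCompactSupport φ →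
    ∫ z, fderiv ℝ φ z (EuclideanSpace.single j 1) • u z = - ∫ z, φ z • w z

/-- `u ∈ H¹(ℝ^ι, V)`: `u` and its weak first partial derivatives belong to `L²`. -/
def MemH1 (u : EuclideanSpace ℝ ι → V) : Prop :=
  MemLp u 2 volume ∧ ∀ j, ∃ w, MemLp w 2 volume ∧ IsWeakPartial j u w

open Classical in
/-- The weak `j`-th partial derivative of `u` in `L²` (unique up to null sets), `0` if there is
none. -/
def weakPartial (j : ι) (u : EuclideanSpace ℝ ι → V) : EuclideanSpace ℝ ι → V :=
  if h : ∃ w, MemLp w 2 volume ∧ IsWeakPartial j u w then h.choose else 0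

/-- `F_λ(u) = ‖∇u‖²_{L²} + λ ‖u‖²_{L²}`. -/
def F (lam : ℝ) (u : EuclideanSpace ℝ ι → V) : ℝ :=
  (∑ j, ∫ z, ‖weakPartial j u z‖ ^ 2) + lam * ∫ z, ‖u z‖ ^ 2

/-- `J_p(u) = ∫ |u|^{p+1}`. -/
def J (p : ℝ) (u : EuclideanSpace ℝ ι → V) : ℝ :=
  ∫ z, ‖u z‖ ^ (p + 1)

/-- The `H¹` norm, `‖u‖²_{H¹} = ‖∇u‖²_{L²} + ‖u‖²_{L²}`. -/
def h1Norm (u : EuclideanSpace ℝ ι → V) : ℝ :=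
  Real.sqrt ((∑ j, ∫ z, ‖weakPartial j u z‖ ^ 2) + ∫ z, ‖u z‖ ^ 2)

end Sobolev

section Equivariant

variable {n : ℕ} (k : ℕ) {V : Type*} [NormedAddCommGroup V] [InnerProductSpace ℂ V]
variable {G : Subgroup (Matrix.specialOrthogonalGroup (Fin n) ℝ)}

/-- `H¹_π(ℝ^{n+k})`: the (representatives of) `u ∈ H¹(ℝ^{n+k}, V)` with `u(gz) = π(g)u(z)` for
all `g ∈ G`, as an identity of elements of `L²`, that is, for almost every `z`. -/
def H1pi (π : G →* (V ≃ₗᵢ[ℂ] V)) : Set (Space n k → V) :=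
  {u | MemH1 u ∧ ∀ g : G,
    ∀ᵐ z, u (act k ((g : Matrix.specialOrthogonalGroup (Fin n) ℝ) : Matrix (Fin n) (Fin n) ℝ) z)
      = π g (u z)}

/-- `I(β, π) = inf {F_λ(u) : u ∈ H¹_π(ℝ^{n+k}), J_p(u) = β}`. -/
def infF (π : G →* (V ≃ₗᵢ[ℂ] V)) (lam p β : ℝ) : ℝ :=
  sInf (F lam '' {u | u ∈ H1pi k π ∧ J p u = β})

end Equivariant

end AxialVortex

end

/-! A minimizing sequence can lose compactness by vanishing, by escaping to infinity, or by
splitting; each is excluded in turn.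

Vanishing. Averaging at scale `2^(-m)` approximates `H¹` functions in every subcritical `L^q` norm
with error `C θ^m ‖u‖_{H¹}`, `θ < 1` (`exists_smoothing_kernels`). As `J_p` is fixed, an average at
one fixed scale must be large at some point, so `u_ν` carries a fixed `L²` mass on a ball of fixed
radius (`exists_ball_mass`). The same estimate yields the Sobolev inequality and local `L²`
compactness.

Escape. The group moves balls without changing the mass on them, because `π` is unitary.
Transitivity on a sphere that is infinite (`n ≥ 2`) gives a ball far from `{0} × ℝᵏ` arbitrarily
many disjoint copies, so bounded total mass keeps the ball near that axis
(`exists_concentration_radius`). Translations along `ℝᵏ` commute with the action and bring the mass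
into one fixed ball; hence the weak limit `v` of the translates `w_ν` is nonzero.

Splitting. For `f_ν = w_ν - v`, orthogonality gives `F(w_ν) = F(v) + F(f_ν) + o(1)`, and a one-sided
Brezis–Lieb inequality gives `β ≤ J(v) + J(f_ν)` up to a small error. By scaling, `F(w) ≥ I
(J(w)/β)^(2/(p+1))` (`infF_mul_le`). Since `2/(p+1) < 1`, having `0 < J(v) < β` would cost strictly
more than `I` (`no_dichotomy`). So `v` is a minimizer and `F(f_ν) → 0`, which is strong convergence
in `H¹` and, by Sobolev, in `L^(p+1)`. -/

noncomputable section

namespace AxialVortex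

set_option linter.unusedSectionVars false

/-! ### Weak convergence in Hilbert spaces and in `L²`. -/

section WeakConvergence

/-- Sequential Banach–Alaoglu for the dual of a separable space, carried back to `H` by the Riesz
isomorphism. -/
theorem exists_weakly_convergent_subseq {H : Type*} [NormedAddCommGroup H] [InnerProductSpace ℝ H]
    [CompleteSpace H] [TopologicalSpace.SeparableSpace H] (x : ℕ → H) (C : ℝ)
    (hx : ∀ n, ‖x n‖ ≤ C) :
    ∃ (a : H) (φ : ℕ → ℕ), StrictMono φ ∧
      ∀ y, Tendsto (fun n => inner ℝ (x (φ n)) y) atTop (𝓝 (inner ℝ a y)) := by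
  have hs := WeakDual.isSeqCompact_closedBall ℝ H (0 : StrongDual ℝ H) C
  obtain ⟨a, -, φ, hφ, ht⟩ := hs (x := fun n =>
    StrongDual.toWeakDual (InnerProductSpace.toDual ℝ H (x n))) (fun n => by
      simpa using hx n)
  refine ⟨(InnerProductSpace.toDual ℝ H).symm (WeakDual.toStrongDual a), φ, hφ, fun y => ?_⟩
  have := ((WeakDual.eval_continuous y).tendsto a).comp ht
  simpa [Function.comp_def] using this

variable {X : Type*} [MeasurableSpace X] {μ : Measure X}
variable {V : Type*} [NormedAddCommGroup V] [InnerProductSpace ℝ V]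

/-- Weak convergence in `L²(μ, V)`, for sequences of functions. -/
def WeakL2 (μ : Measure X) (f : ℕ → X → V) (g : X → V) : Prop :=
  ∀ h : X → V, MemLp h 2 μ → Tendsto (fun n => ∫ x, inner ℝ (f n x) (h x) ∂μ) atTop
    (𝓝 (∫ x, inner ℝ (g x) (h x) ∂μ))

theorem integrable_inner_of_memLp {f g : X → V} (hf : MemLp f 2 μ) (hg : MemLp g 2 μ) :
    Integrable (fun x => inner ℝ (f x) (g x)) μ := by
  refine (L2.integrable_inner (𝕜 := ℝ) (hf.toLp f) (hg.toLp g)).congr ?_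
  filter_upwards [hf.coeFn_toLp, hg.coeFn_toLp] with x h1 h2
  rw [h1, h2]

theorem inner_toLp_eq_integral {f g : X → V} (hf : MemLp f 2 μ) (hg : MemLp g 2 μ) :
    inner ℝ (hf.toLp f) (hg.toLp g) = ∫ x, inner ℝ (f x) (g x) ∂μ := by
  rw [L2.inner_def]
  refine integral_congr_ae ?_
  filter_upwards [hf.coeFn_toLp, hg.coeFn_toLp] with x h1 h2
  rw [h1, h2]

theorem norm_toLp_sq_eq_integral {f : X → V} (hf : MemLp f 2 μ) :
    ‖hf.toLp f‖ ^ 2 = ∫ x, ‖f x‖ ^ 2 ∂μ := by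
  rw [← real_inner_self_eq_norm_sq, inner_toLp_eq_integral]
  simp

theorem exists_weakL2_subseq {κ : Type*} [Fintype κ] [CompleteSpace V]
    [TopologicalSpace.SeparableSpace (Lp V 2 μ)]
    (f : κ → ℕ → X → V) (hf : ∀ i n, MemLp (f i n) 2 μ) (C : ℝ)
    (hC : ∀ i n, ∫ x, ‖f i n x‖ ^ 2 ∂μ ≤ C) :
    ∃ (g : κ → X → V) (φ : ℕ → ℕ), StrictMono φ ∧ (∀ i, MemLp (g i) 2 μ) ∧
      ∀ i, WeakL2 μ (fun n => f i (φ n)) (g i) := by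
  classical
  -- All the sequences are packed into one sequence in the Hilbert sum, so that a single subsequence
  -- serves every index; testing against vectors supported at `i` recovers the components.
  let x : ℕ → PiLp 2 (fun _ : κ => Lp V 2 μ) := fun n =>
    WithLp.toLp 2 fun i => (hf i n).toLp (f i n)
  obtain ⟨a, φ, hφ, ha⟩ := exists_weakly_convergent_subseq x (Real.sqrt (∑ _i : κ, C)) (fun n => by
    rw [PiLp.norm_eq_of_L2]
    refine Real.sqrt_le_sqrt (Finset.sum_le_sum fun i _ => ?_)
    simp only [x]
    rw [norm_toLp_sq_eq_integral]
    exact hC i n)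
  refine ⟨fun i => a i, φ, hφ, fun i => Lp.memLp _, fun i h hh => ?_⟩
  have hin : ∀ z : PiLp 2 (fun _ : κ => Lp V 2 μ),
      inner ℝ z (WithLp.toLp 2 (Pi.single i (hh.toLp h))) = inner ℝ (z i) (hh.toLp h) := by
    intro z
    rw [PiLp.inner_apply, Finset.sum_eq_single i] <;> simp +contextual
  have := ha (WithLp.toLp 2 (Pi.single i (hh.toLp h)))
  simp only [hin] at this
  have e : a i = (Lp.memLp (a i)).toLp _ := (Lp.toLp_coeFn _ _).symm
  simp only [x, inner_toLp_eq_integral] at this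
  rw [e, inner_toLp_eq_integral] at this
  exact this

/-- In an orthonormal basis of `V`, each coordinate of the vector-valued integral is a pairing with
the `L²` function `φ • b i`. -/
theorem WeakL2.tendsto_integral_smul [FiniteDimensional ℝ V] {f : ℕ → X → V} {g : X → V}
    (h : WeakL2 μ f g) (hf : ∀ n, MemLp (f n) 2 μ) (hg : MemLp g 2 μ)
    {φ : X → ℝ} (hφ : MemLp φ 2 μ) :
    Tendsto (fun n => ∫ x, φ x • f n x ∂μ) atTop (𝓝 (∫ x, φ x • g x ∂μ)) := by
  let b := stdOrthonormalBasis ℝ V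
  have key : ∀ (k : X → V), MemLp k 2 μ → ∀ e : V,
      inner ℝ e (∫ x, φ x • k x ∂μ) = ∫ x, inner ℝ (k x) (φ x • e) ∂μ := by
    intro k hk e
    rw [← integral_inner (f := fun x => φ x • k x) (memLp_one_iff_integrable.1 (hk.smul hφ))]
    refine integral_congr_ae (Eventually.of_forall fun x => ?_)
    simp [inner_smul_right, real_inner_comm]
  have hb : ∀ e : V, MemLp (fun x => φ x • e) 2 μ := fun e =>
    (ContinuousLinearMap.toSpanSingleton ℝ e).comp_memLp' hφ
  have hexp : ∀ (k : X → V), MemLp k 2 μ → ∫ x, φ x • k x ∂μ =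
      ∑ i, (∫ x, inner ℝ (k x) (φ x • b i) ∂μ) • b i := by
    intro k hk
    rw [← b.sum_repr' (∫ x, φ x • k x ∂μ)]
    exact Finset.sum_congr rfl fun i _ => by rw [key k hk]
  rw [hexp g hg]
  simp only [hexp _ (hf _)]
  exact tendsto_finsetSum _ fun i _ => (h _ (hb (b i))).smul_const (b i)

/-- Expanding the square leaves `2⟨f n, g⟩ - ‖g‖²`, which is affine in `f n` and so passes to the
weak limit. -/
theorem WeakL2.tendsto_integral_norm_sq_sub {f : ℕ → X → V} {g : X → V}
    (h : WeakL2 μ f g) (hf : ∀ n, MemLp (f n) 2 μ) (hg : MemLp g 2 μ) :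
    Tendsto (fun n => (∫ x, ‖f n x‖ ^ 2 ∂μ) - ∫ x, ‖f n x - g x‖ ^ 2 ∂μ) atTop
      (𝓝 (∫ x, ‖g x‖ ^ 2 ∂μ)) := by
  have h1 := ((h g hg).const_mul 2).sub_const (∫ x, ‖g x‖ ^ 2 ∂μ)
  have e : ∫ x, inner ℝ (g x) (g x) ∂μ = ∫ x, ‖g x‖ ^ 2 ∂μ := by simp
  rw [e, show ∀ t : ℝ, 2 * t - t = t by intro t; ring] at h1
  refine h1.congr fun n => ?_
  have i1 := integrable_inner_of_memLp (hf n) hg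
  have i2 := integrable_inner_of_memLp (hf n) (hf n)
  have i3 := integrable_inner_of_memLp hg hg
  simp only [real_inner_self_eq_norm_sq] at i2 i3
  have : ∀ x, ‖f n x - g x‖ ^ 2 = ‖f n x‖ ^ 2 - 2 * inner ℝ (f n x) (g x) + ‖g x‖ ^ 2 :=
    fun x => norm_sub_sq_real _ _
  have e1 : ∫ x, ‖f n x - g x‖ ^ 2 ∂μ =
      (∫ x, ‖f n x‖ ^ 2 ∂μ) - 2 * (∫ x, inner ℝ (f n x) (g x) ∂μ) + ∫ x, ‖g x‖ ^ 2 ∂μ := by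
    rw [← integral_const_mul, ← integral_sub i2 (i1.const_mul 2)]
    exact (integral_congr_ae (Eventually.of_forall this)).trans
      (integral_add (i2.sub (i1.const_mul 2)) i3)
  rw [e1]
  ring

end WeakConvergence

/-! ### Weak derivatives, the functional `F`, and weak limits in `H¹`. -/

section WeakDerivative

attribute [local instance] InnerProductSpace.complexToReal

variable {ι : Type*} [Fintype ι] [DecidableEq ι]
variable {V : Type*} [NormedAddCommGroup V] [InnerProductSpace ℂ V]

theorem memLp_fderiv_apply {φ : EuclideanSpace ℝ ι → ℝ} (hφ : ContDiff ℝ ∞ φ)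
    (hc : HasCompactSupport φ) (e : EuclideanSpace ℝ ι) (q : ℝ≥0∞) :
    MemLp (fun z => fderiv ℝ φ z e) q volume := by
  refine Continuous.memLp_of_hasCompactSupport ?_ ?_
  · exact (hφ.continuous_fderiv (by simp)).clm_apply continuous_const
  · exact hc.fderiv_apply ℝ e

theorem integrable_smul_of_memLp_two {X : Type*} [MeasurableSpace X] {μ : Measure X}
    {W : Type*} [NormedAddCommGroup W] [NormedSpace ℝ W] {φ : X → ℝ} {u : X → W}
    (hφ : MemLp φ 2 μ) (hu : MemLp u 2 μ) : Integrable (fun z => φ z • u z) μ :=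
  memLp_one_iff_integrable.1 (hu.smul hφ)

theorem integral_norm_sq_eq_toReal_eLpNorm_sq {X : Type*} [MeasurableSpace X] {μ : Measure X}
    {W : Type*} [NormedAddCommGroup W] {u : X → W} (hu : MemLp u 2 μ) :
    ∫ z, ‖u z‖ ^ 2 ∂μ = (eLpNorm u 2 μ).toReal ^ 2 := by
  have h := hu.eLpNorm_eq_integral_rpow_norm (by simp) (by simp)
  have h0 : 0 ≤ ∫ z, ‖u z‖ ^ 2 ∂μ := integral_nonneg fun z => by positivity
  simp only [ENNReal.toReal_ofNat, Real.rpow_ofNat] at h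
  rw [h, ENNReal.toReal_ofReal (by positivity), ← Real.rpow_natCast, ← Real.rpow_mul h0]
  norm_num

theorem IsWeakPartial.sub {j : ι} {u u' w w' : EuclideanSpace ℝ ι → V}
    (h : IsWeakPartial j u w) (h' : IsWeakPartial j u' w') (hu : MemLp u 2 volume)
    (hu' : MemLp u' 2 volume) (hw : MemLp w 2 volume) (hw' : MemLp w' 2 volume) :
    IsWeakPartial j (u - u') (w - w') := by
  intro φ hφ hc
  have m1 := memLp_fderiv_apply hφ hc (EuclideanSpace.single j 1) 2
  have m2 : MemLp φ 2 volume := hφ.continuous.memLp_of_hasCompactSupport hc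
  simp only [Pi.sub_apply, smul_sub]
  rw [integral_sub (integrable_smul_of_memLp_two m1 hu) (integrable_smul_of_memLp_two m1 hu'),
    integral_sub (integrable_smul_of_memLp_two m2 hw) (integrable_smul_of_memLp_two m2 hw'),
    h φ hφ hc, h' φ hφ hc]
  abel

theorem IsWeakPartial.const_smul {j : ι} {u w : EuclideanSpace ℝ ι → V}
    (h : IsWeakPartial j u w) (c : ℝ) : IsWeakPartial j (c • u) (c • w) := by
  intro φ hφ hc
  simp only [Pi.smul_apply, smul_comm _ c]
  rw [integral_smul, integral_smul, h φ hφ hc, smul_neg]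

theorem IsWeakPartial.comp_add_right {j : ι} {u w : EuclideanSpace ℝ ι → V}
    (h : IsWeakPartial j u w) (a : EuclideanSpace ℝ ι) :
    IsWeakPartial j (fun z => u (z + a)) (fun z => w (z + a)) := by
  intro φ hφ hc
  have hφ' : ContDiff ℝ ∞ (fun z => φ (z - a)) := hφ.comp (contDiff_id.sub contDiff_const)
  have hc' : HasCompactSupport (fun z => φ (z - a)) :=
    hc.comp_homeomorph (Homeomorph.subRight a)
  have := h _ hφ' hc'
  rw [← integral_add_right_eq_self _ a, ← integral_add_right_eq_self (fun z => φ (z - a) • w z) a]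
    at this
  simpa [fderiv_comp_sub] using this

/-- Makes the choice in `weakPartial` harmless: any `L²` weak derivative may replace it under an
integral. -/
theorem IsWeakPartial.ae_unique [CompleteSpace V] {j : ι} {u w w' : EuclideanSpace ℝ ι → V}
    (h : IsWeakPartial j u w) (h' : IsWeakPartial j u w') (hw : MemLp w 2 volume)
    (hw' : MemLp w' 2 volume) : w =ᵐ[volume] w' := by
  refine ae_eq_of_integral_contDiff_smul_eq (hw.locallyIntegrable (by norm_num))
    (hw'.locallyIntegrable (by norm_num)) fun φ hφ hc => ?_
  rw [← neg_inj, ← h φ hφ hc, h' φ hφ hc]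

theorem IsWeakPartial.of_weakL2 [FiniteDimensional ℝ V] {j : ι}
    {u w : ℕ → EuclideanSpace ℝ ι → V}
    {v g : EuclideanSpace ℝ ι → V} (h : ∀ n, IsWeakPartial j (u n) (w n))
    (hu : ∀ n, MemLp (u n) 2 volume) (hw : ∀ n, MemLp (w n) 2 volume)
    (hv : MemLp v 2 volume) (hg : MemLp g 2 volume)
    (huv : WeakL2 volume u v) (hwg : WeakL2 volume w g) : IsWeakPartial j v g := by
  intro φ hφ hc
  have m1 := memLp_fderiv_apply hφ hc (EuclideanSpace.single j 1) 2
  have m2 : MemLp φ 2 volume := hφ.continuous.memLp_of_hasCompactSupport hc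
  have t1 := huv.tendsto_integral_smul hu hv m1
  have t2 := (hwg.tendsto_integral_smul hw hg m2).neg
  refine tendsto_nhds_unique t1 (t2.congr fun n => ?_)
  rw [h n φ hφ hc]

variable {u v : EuclideanSpace ℝ ι → V}

theorem MemH1.memLp_weakPartial (hu : MemH1 u) (j : ι) : MemLp (weakPartial j u) 2 volume := by
  rw [weakPartial, dif_pos (hu.2 j)]
  exact (hu.2 j).choose_spec.1

theorem MemH1.isWeakPartial (hu : MemH1 u) (j : ι) : IsWeakPartial j u (weakPartial j u) := by
  rw [weakPartial, dif_pos (hu.2 j)]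
  exact (hu.2 j).choose_spec.2

theorem weakPartial_ae_eq [CompleteSpace V] {j : ι} {w : EuclideanSpace ℝ ι → V}
    (hw : MemLp w 2 volume) (h : IsWeakPartial j u w) : weakPartial j u =ᵐ[volume] w := by
  have hex : ∃ w, MemLp w 2 volume ∧ IsWeakPartial j u w := ⟨w, hw, h⟩
  rw [weakPartial, dif_pos hex]
  exact hex.choose_spec.2.ae_unique h hex.choose_spec.1 hw

theorem MemH1.sub (hu : MemH1 u) (hv : MemH1 v) : MemH1 (u - v) :=
  ⟨hu.1.sub hv.1, fun j => ⟨_, (hu.memLp_weakPartial j).sub (hv.memLp_weakPartial j),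
    (hu.isWeakPartial j).sub (hv.isWeakPartial j) hu.1 hv.1 (hu.memLp_weakPartial j)
      (hv.memLp_weakPartial j)⟩⟩

theorem MemH1.weakPartial_sub [CompleteSpace V] (hu : MemH1 u) (hv : MemH1 v) (j : ι) :
    weakPartial j (u - v) =ᵐ[volume] weakPartial j u - weakPartial j v :=
  weakPartial_ae_eq ((hu.memLp_weakPartial j).sub (hv.memLp_weakPartial j))
    ((hu.isWeakPartial j).sub (hv.isWeakPartial j) hu.1 hv.1 (hu.memLp_weakPartial j)
      (hv.memLp_weakPartial j))

theorem MemH1.const_smul (hu : MemH1 u) (c : ℝ) : MemH1 (c • u) :=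
  ⟨hu.1.const_smul c, fun j => ⟨_, (hu.memLp_weakPartial j).const_smul c,
    (hu.isWeakPartial j).const_smul c⟩⟩

theorem memLp_comp_add_right {q : ℝ≥0∞} (hu : MemLp u q volume) (a : EuclideanSpace ℝ ι) :
    MemLp (fun z => u (z + a)) q volume :=
  hu.comp_measurePreserving (measurePreserving_add_right volume a)

theorem MemH1.comp_add_right (hu : MemH1 u) (a : EuclideanSpace ℝ ι) :
    MemH1 (fun z => u (z + a)) :=
  ⟨memLp_comp_add_right hu.1 a, fun j => ⟨_, memLp_comp_add_right (hu.memLp_weakPartial j) a,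
    (hu.isWeakPartial j).comp_add_right a⟩⟩

theorem integral_norm_sq_congr {f g : EuclideanSpace ℝ ι → V} (h : f =ᵐ[volume] g) :
    ∫ z, ‖f z‖ ^ 2 = ∫ z, ‖g z‖ ^ 2 :=
  integral_congr_ae (by filter_upwards [h] with z hz; rw [hz])

theorem F_const_smul [CompleteSpace V] (hu : MemH1 u) (lam c : ℝ) :
    F lam (c • u) = c ^ 2 * F lam u := by
  have h : ∀ f : EuclideanSpace ℝ ι → V, ∫ z, ‖(c • f) z‖ ^ 2 = c ^ 2 * ∫ z, ‖f z‖ ^ 2 := by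
    intro f
    rw [← integral_const_mul]
    simp [norm_smul, mul_pow]
  have hw : ∀ j, ∫ z, ‖weakPartial j (c • u) z‖ ^ 2 = c ^ 2 * ∫ z, ‖weakPartial j u z‖ ^ 2 := by
    intro j
    rw [← h]
    exact integral_norm_sq_congr (weakPartial_ae_eq ((hu.memLp_weakPartial j).const_smul c)
      ((hu.isWeakPartial j).const_smul c))
  simp only [F, hw, h, ← Finset.mul_sum]
  ring

theorem F_comp_add_right [CompleteSpace V] (hu : MemH1 u) (lam : ℝ) (a : EuclideanSpace ℝ ι) :
    F lam (fun z => u (z + a)) = F lam u := by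
  have hw : ∀ j, ∫ z, ‖weakPartial j (fun z => u (z + a)) z‖ ^ 2
      = ∫ z, ‖weakPartial j u z‖ ^ 2 := by
    intro j
    rw [integral_norm_sq_congr (weakPartial_ae_eq
      (memLp_comp_add_right (hu.memLp_weakPartial j) a) ((hu.isWeakPartial j).comp_add_right a))]
    exact integral_add_right_eq_self (fun z => ‖weakPartial j u z‖ ^ 2) a
  simp only [F, hw]
  rw [integral_add_right_eq_self (fun z => ‖u z‖ ^ 2) a]

theorem J_comp_add_right (p : ℝ) (a : EuclideanSpace ℝ ι) :
    J p (fun z => u (z + a)) = J p u :=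
  integral_add_right_eq_self (fun z => ‖u z‖ ^ (p + 1)) a

theorem F_nonneg {lam : ℝ} (hlam : 0 ≤ lam) : 0 ≤ F lam u :=
  add_nonneg (Finset.sum_nonneg fun _ _ => integral_nonneg fun _ => by positivity)
    (mul_nonneg hlam (integral_nonneg fun _ => by positivity))

theorem h1Norm_eq_sqrt_F : h1Norm u = Real.sqrt (F 1 u) := by simp [h1Norm, F]

theorem F_one_le {lam : ℝ} (hlam : 0 < lam) : F 1 u ≤ (1 + lam⁻¹) * F lam u := by
  have h1 : 0 ≤ ∑ j, ∫ z, ‖weakPartial j u z‖ ^ 2 :=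
    Finset.sum_nonneg fun _ _ => integral_nonneg fun _ => by positivity
  have h2 : 0 ≤ ∫ z, ‖u z‖ ^ 2 := integral_nonneg fun _ => by positivity
  have e : (1 + lam⁻¹) * F lam u = F 1 u + lam⁻¹ * (∑ j, ∫ z, ‖weakPartial j u z‖ ^ 2)
      + lam * ∫ z, ‖u z‖ ^ 2 := by
    simp only [F]
    field_simp
    ring
  rw [e]
  have : 0 ≤ lam⁻¹ * (∑ j, ∫ z, ‖weakPartial j u z‖ ^ 2) := by positivity
  have : 0 ≤ lam * ∫ z, ‖u z‖ ^ 2 := by positivity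
  linarith

theorem integral_norm_sq_le_F_one : ∫ z, ‖u z‖ ^ 2 ≤ F 1 u := by
  simpa [F] using Finset.sum_nonneg (s := Finset.univ) fun j _ =>
    integral_nonneg (μ := volume) (f := fun z => ‖weakPartial j u z‖ ^ 2) fun z => by positivity

theorem integral_weakPartial_sq_le_F_one (j : ι) : ∫ z, ‖weakPartial j u z‖ ^ 2 ≤ F 1 u := by
  have h2 : 0 ≤ ∫ z, ‖u z‖ ^ 2 := integral_nonneg fun _ => by positivity
  have := Finset.single_le_sum (f := fun j => ∫ z, ‖weakPartial j u z‖ ^ 2)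
    (fun i _ => integral_nonneg fun z => by positivity) (Finset.mem_univ j)
  simp only [F, one_mul]
  linarith

theorem eLpNorm_le_of_integral_sq_le {f : EuclideanSpace ℝ ι → V} (hf : MemLp f 2 volume) {c : ℝ}
    (h : ∫ z, ‖f z‖ ^ 2 ≤ c) : eLpNorm f 2 volume ≤ ENNReal.ofReal (Real.sqrt c) := by
  rw [integral_norm_sq_eq_toReal_eLpNorm_sq hf] at h
  rw [← ENNReal.ofReal_toReal hf.2.ne]
  exact ENNReal.ofReal_le_ofReal (Real.le_sqrt_of_sq_le h)

theorem MemH1.eLpNorm_le (hu : MemH1 u) : eLpNorm u 2 volume ≤ ENNReal.ofReal (h1Norm u) := by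
  rw [h1Norm_eq_sqrt_F]
  exact eLpNorm_le_of_integral_sq_le hu.1 integral_norm_sq_le_F_one

theorem MemH1.eLpNorm_weakPartial_le (hu : MemH1 u) (j : ι) :
    eLpNorm (weakPartial j u) 2 volume ≤ ENNReal.ofReal (h1Norm u) := by
  rw [h1Norm_eq_sqrt_F]
  exact eLpNorm_le_of_integral_sq_le (hu.memLp_weakPartial j) (integral_weakPartial_sq_le_F_one j)

/-- Bounded sequences in `H¹` have weakly convergent subsequences, and the energies split along
the weak limit. -/
theorem exists_weak_limit [FiniteDimensional ℝ V] (u : ℕ → EuclideanSpace ℝ ι → V)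
    (hu : ∀ n, MemH1 (u n)) (C : ℝ) (hC : ∀ n, F 1 (u n) ≤ C) :
    ∃ (v : EuclideanSpace ℝ ι → V) (φ : ℕ → ℕ), StrictMono φ ∧ MemH1 v ∧
      WeakL2 volume (fun n => u (φ n)) v ∧
      ∀ lam, Tendsto (fun n => F lam (u (φ n)) - F lam (u (φ n) - v)) atTop (𝓝 (F lam v)) := by
  have : CompleteSpace V := FiniteDimensional.complete ℝ V
  have : ProperSpace V := FiniteDimensional.proper_real V
  have : Fact ((2 : ℝ≥0∞) ≠ ⊤) := ⟨ENNReal.ofNat_ne_top⟩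
  -- The index `none` stands for the function itself and `some j` for its `j`-th derivative, so one
  -- extraction handles both.
  obtain ⟨g, φ, hφ, hg, hw⟩ := exists_weakL2_subseq (μ := (volume : Measure (EuclideanSpace ℝ ι)))
    (V := V)
    (fun (i : Option ι) n => i.elim (u n) (fun j => weakPartial j (u n)))
    (fun i n => match i with
      | none => (hu n).1
      | some j => (hu n).memLp_weakPartial j) C
    (fun i n => match i with
      | none => integral_norm_sq_le_F_one.trans (hC n)
      | some j => (integral_weakPartial_sq_le_F_one j).trans (hC n))
  have hw0 : WeakL2 volume (fun n => u (φ n)) (g none) := hw none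
  have hwj : ∀ j, WeakL2 volume (fun n => weakPartial j (u (φ n))) (g (some j)) :=
    fun j => hw (some j)
  have hp : ∀ j, IsWeakPartial j (g none) (g (some j)) := fun j =>
    IsWeakPartial.of_weakL2 (fun n => (hu (φ n)).isWeakPartial j) (fun n => (hu _).1)
      (fun n => (hu _).memLp_weakPartial j) (hg _) (hg _) hw0 (hwj j)
  have hv : MemH1 (g none) := ⟨hg none, fun j => ⟨_, hg _, hp j⟩⟩
  refine ⟨g none, φ, hφ, hv, hw0, fun lam => ?_⟩
  have t0 := (hw0.tendsto_integral_norm_sq_sub (fun n => (hu _).1) (hg _)).const_mul lam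
  have tj := tendsto_finsetSum Finset.univ fun j (_ : j ∈ Finset.univ) =>
    (hwj j).tendsto_integral_norm_sq_sub (fun n => (hu (φ n)).memLp_weakPartial j) (hg _)
  have e : F lam (g none) = (∑ j, ∫ z, ‖g (some j) z‖ ^ 2) + lam * ∫ z, ‖g none z‖ ^ 2 := by
    rw [F]
    congr 1
    exact Finset.sum_congr rfl fun j _ => integral_norm_sq_congr (weakPartial_ae_eq (hg _) (hp j))
  rw [e]
  refine (tj.add t0).congr fun n => ?_
  have ej : ∀ j, ∫ z, ‖weakPartial j (u (φ n) - g none) z‖ ^ 2 =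
      ∫ z, ‖weakPartial j (u (φ n)) z - g (some j) z‖ ^ 2 := fun j =>
    integral_norm_sq_congr (((hu (φ n)).weakPartial_sub hv j).trans (by
      filter_upwards [weakPartial_ae_eq (hg _) (hp j)] with z hz
      simp [hz]))
  simp only [F, ej, Finset.sum_sub_distrib, Pi.sub_apply]
  ring

end WeakDerivative

/-! ### An averaging kernel whose dyadic dilates differ by a divergence. -/

section Kernel

/-- A smooth cut-off on the line: `1` on `(-∞, 1]` and `0` on `[2, ∞)`. -/
def cutoff (s : ℝ) : ℝ := Real.smoothTransition (2 - s)

theorem cutoff_of_le_one {s : ℝ} (h : s ≤ 1) : cutoff s = 1 :=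
  Real.smoothTransition.one_of_one_le (by linarith)

theorem cutoff_of_two_le {s : ℝ} (h : 2 ≤ s) : cutoff s = 0 :=
  Real.smoothTransition.zero_of_nonpos (by linarith)

theorem contDiff_cutoff : ContDiff ℝ ∞ cutoff :=
  Real.smoothTransition.contDiff.comp (contDiff_const.sub contDiff_id)

theorem antitone_cutoff : Antitone cutoff := fun a b h =>
  Real.smoothTransition.monotone (by linarith)

theorem deriv_cutoff_of_lt_one {s : ℝ} (h : s < 1) : deriv cutoff s = 0 := by
  have : cutoff =ᶠ[𝓝 s] fun _ => 1 := by
    filter_upwards [Iio_mem_nhds h] with t ht using cutoff_of_le_one (le_of_lt ht)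
  rw [this.deriv_eq, deriv_const]

theorem deriv_cutoff_of_two_lt {s : ℝ} (h : 2 < s) : deriv cutoff s = 0 := by
  have : cutoff =ᶠ[𝓝 s] fun _ => 0 := by
    filter_upwards [Ioi_mem_nhds h] with t ht using cutoff_of_two_le (le_of_lt ht)
  rw [this.deriv_eq, deriv_const]

theorem exists_deriv_cutoff_ne_zero : ∃ s, deriv cutoff s ≠ 0 := by
  by_contra! h
  have := is_const_of_deriv_eq_zero (contDiff_cutoff.differentiable (by simp)) h 1 2
  rw [cutoff_of_le_one le_rfl, cutoff_of_two_le le_rfl] at this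
  norm_num at this

/-- The profile of the averaging kernel. -/
def kernelProfile (N : ℕ) (s : ℝ) : ℝ := -(2 * s * s ^ (-(N : ℝ) / 2) * deriv cutoff s)

/-- The profile of the vector field whose divergence is the difference of two averaging kernels. -/
def fluxProfile (N : ℕ) (s : ℝ) : ℝ := s ^ (-(N : ℝ) / 2) * (cutoff s - cutoff (4 * s))

theorem contDiff_kernelProfile (N : ℕ) : ContDiff ℝ ∞ (kernelProfile N) := by
  rw [contDiff_iff_contDiffAt]
  intro s
  rcases lt_or_ge s 1 with h | h
  · refine (contDiffAt_const (c := (0 : ℝ))).congr_of_eventuallyEq ?_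
    filter_upwards [Iio_mem_nhds h] with t ht
    simp [kernelProfile, deriv_cutoff_of_lt_one ht]
  · have hd : ContDiff ℝ ∞ (deriv cutoff) := (contDiff_infty_iff_deriv.1 contDiff_cutoff).2
    exact (((contDiffAt_const.mul contDiffAt_id).mul
      (Real.contDiffAt_rpow_const_of_ne (by linarith))).mul hd.contDiffAt).neg

theorem contDiff_fluxProfile (N : ℕ) : ContDiff ℝ ∞ (fluxProfile N) := by
  rw [contDiff_iff_contDiffAt]
  intro s
  rcases lt_or_ge s (1 / 4) with h | h
  · refine (contDiffAt_const (c := (0 : ℝ))).congr_of_eventuallyEq ?_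
    filter_upwards [Iio_mem_nhds h] with t ht
    have ht' : t < 1 / 4 := ht
    rw [fluxProfile, cutoff_of_le_one (by linarith), cutoff_of_le_one (by linarith), sub_self,
      mul_zero]
  · exact (Real.contDiffAt_rpow_const_of_ne (by linarith)).mul
      (contDiff_cutoff.sub (contDiff_cutoff.comp (contDiff_const.mul contDiff_id))).contDiffAt

/-- With `s = ‖z‖²`, the right side is the divergence of `z ↦ z * fluxProfile N (‖z‖²)`. Away from
the origin `z ‖z‖^(-N)` is divergence-free, so only derivatives of the two cutoffs survive, and
these are the two dilates of the kernel. -/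
theorem kernelProfile_scaling (N : ℕ) {s : ℝ} (hs : 0 ≤ s) :
    2 ^ N * kernelProfile N (4 * s) - kernelProfile N s =
      N * fluxProfile N s + 2 * s * deriv (fluxProfile N) s := by
  rcases lt_or_ge s (1 / 4) with h | h
  · have : fluxProfile N =ᶠ[𝓝 s] fun _ => 0 := by
      filter_upwards [Iio_mem_nhds h] with t ht
      have ht' : t < 1 / 4 := ht
      rw [fluxProfile, cutoff_of_le_one (by linarith), cutoff_of_le_one (by linarith), sub_self,
        mul_zero]
    rw [this.deriv_eq, deriv_const, this.eq_of_nhds, kernelProfile, kernelProfile,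
      deriv_cutoff_of_lt_one (by linarith), deriv_cutoff_of_lt_one (by linarith)]
    ring
  · have hs0 : s ≠ 0 := by linarith
    have hc : ∀ t, HasDerivAt cutoff (deriv cutoff t) t := fun t =>
      ((contDiff_cutoff.differentiable (by simp)) t).hasDerivAt
    have h4 : HasDerivAt (fun t => cutoff (4 * t)) (deriv cutoff (4 * s) * (4 * 1)) s :=
      (hc (4 * s)).comp s ((hasDerivAt_id s).const_mul 4)
    have hd : HasDerivAt (fluxProfile N) _ s :=
      (Real.hasDerivAt_rpow_const (p := -(N : ℝ) / 2) (Or.inl hs0)).mul ((hc s).sub h4)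
    have e1 : s * s ^ (-(N : ℝ) / 2 - 1) = s ^ (-(N : ℝ) / 2) := by
      rw [Real.rpow_sub_one hs0]
      field_simp
    have e2 : (2 : ℝ) ^ N * (4 * s) ^ (-(N : ℝ) / 2) = s ^ (-(N : ℝ) / 2) := by
      rw [Real.mul_rpow (by norm_num) hs, show (4 : ℝ) = 2 ^ (2 : ℝ) by norm_num,
        ← Real.rpow_mul (by norm_num), ← mul_assoc, ← Real.rpow_natCast,
        ← Real.rpow_add (by norm_num)]
      ring_nf
      simp
    rw [hd.deriv, kernelProfile, kernelProfile, fluxProfile]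
    linear_combination (-(8 * s) * deriv cutoff (4 * s)) * e2 +
      N * (cutoff s - cutoff (4 * s)) * e1

variable {ι : Type*} [Fintype ι] [DecidableEq ι]

theorem contDiff_comp_norm_sq {f : ℝ → ℝ} (hf : ContDiff ℝ ∞ f) :
    ContDiff ℝ ∞ fun z : EuclideanSpace ℝ ι => f (‖z‖ ^ 2) :=
  hf.comp (contDiff_norm_sq ℝ)

theorem hasCompactSupport_comp_norm_sq {f : ℝ → ℝ} (hf : ∀ s, 2 < s → f s = 0) :
    HasCompactSupport fun z : EuclideanSpace ℝ ι => f (‖z‖ ^ 2) := by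
  refine HasCompactSupport.intro (isCompact_closedBall (0 : EuclideanSpace ℝ ι) 2) fun z hz => ?_
  refine hf _ ?_
  have : 2 < ‖z‖ := by simpa using hz
  nlinarith

theorem sum_fderiv_coord_mul_radial {f : ℝ → ℝ} (hf : ContDiff ℝ ∞ f) (z : EuclideanSpace ℝ ι) :
    ∑ j, fderiv ℝ (fun z : EuclideanSpace ℝ ι => z j * f (‖z‖ ^ 2)) z (EuclideanSpace.single j 1) =
      Fintype.card ι * f (‖z‖ ^ 2) + 2 * ‖z‖ ^ 2 * deriv f (‖z‖ ^ 2) := by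
  have h : ∀ j, fderiv ℝ (fun z : EuclideanSpace ℝ ι => z j * f (‖z‖ ^ 2)) z
      (EuclideanSpace.single j 1) = f (‖z‖ ^ 2) + 2 * deriv f (‖z‖ ^ 2) * (z j) ^ 2 := by
    intro j
    have h1 : HasFDerivAt (fun z : EuclideanSpace ℝ ι => z j)
      (EuclideanSpace.proj j : EuclideanSpace ℝ ι →L[ℝ] ℝ) z :=
      (EuclideanSpace.proj j : EuclideanSpace ℝ ι →L[ℝ] ℝ).hasFDerivAt
    have h2 := ((hf.differentiable (by simp)) (‖z‖ ^ 2)).hasDerivAt.comp_hasFDerivAt z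
      (hasStrictFDerivAt_norm_sq z).hasFDerivAt
    have := (h1.mul h2).fderiv
    simp only [Function.comp_def] at this
    rw [show (fun z : EuclideanSpace ℝ ι => z j * f (‖z‖ ^ 2)) =
      (fun z : EuclideanSpace ℝ ι => z j) * (fun z => f (‖z‖ ^ 2)) from rfl]
    rw [this]
    simp [EuclideanSpace.inner_single_right]
    ring
  simp only [h, Finset.sum_add_distrib, ← Finset.mul_sum]
  rw [EuclideanSpace.real_norm_sq_eq]
  simp
  ring

/-- A smooth averaging kernel whose dilates differ by the divergence of a compactly supported
smooth vector field. -/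
theorem exists_averaging_kernel [Nonempty ι] :
    ∃ (ρ : EuclideanSpace ℝ ι → ℝ) (Ψ : ι → EuclideanSpace ℝ ι → ℝ),
      ContDiff ℝ ∞ ρ ∧ HasCompactSupport ρ ∧ ∫ z, ρ z = 1 ∧
      (∀ j, ContDiff ℝ ∞ (Ψ j)) ∧ (∀ j, HasCompactSupport (Ψ j)) ∧
      ∀ z, 2 ^ Fintype.card ι * ρ ((2 : ℝ) • z) - ρ z =
        ∑ j, fderiv ℝ (Ψ j) z (EuclideanSpace.single j 1) := by
  set N := Fintype.card ι
  let ρ₀ : EuclideanSpace ℝ ι → ℝ := fun z => kernelProfile N (‖z‖ ^ 2)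
  let Ψ₀ : ι → EuclideanSpace ℝ ι → ℝ := fun j z => z j * fluxProfile N (‖z‖ ^ 2)
  have hρ : ContDiff ℝ ∞ ρ₀ := contDiff_comp_norm_sq (contDiff_kernelProfile N)
  have hρc : HasCompactSupport ρ₀ := hasCompactSupport_comp_norm_sq fun s hs => by
    rw [kernelProfile, deriv_cutoff_of_two_lt hs, mul_zero, neg_zero]
  have hΨ : ∀ j, ContDiff ℝ ∞ (Ψ₀ j) := fun j =>
    (EuclideanSpace.proj j : EuclideanSpace ℝ ι →L[ℝ] ℝ).contDiff.mul
      (contDiff_comp_norm_sq (contDiff_fluxProfile N))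
  have hΨc : ∀ j, HasCompactSupport (Ψ₀ j) := fun j =>
    HasCompactSupport.mul_left (hasCompactSupport_comp_norm_sq fun s hs => by
      rw [fluxProfile, cutoff_of_two_le hs.le, cutoff_of_two_le (by linarith), sub_self, mul_zero])
  have hrel : ∀ z, 2 ^ N * ρ₀ ((2 : ℝ) • z) - ρ₀ z =
      ∑ j, fderiv ℝ (Ψ₀ j) z (EuclideanSpace.single j 1) := by
    intro z
    have e : ‖(2 : ℝ) • z‖ ^ 2 = 4 * ‖z‖ ^ 2 := by
      rw [norm_smul, mul_pow]
      norm_num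
    simp only [ρ₀, Ψ₀]
    rw [sum_fderiv_coord_mul_radial (contDiff_fluxProfile N), e,
      kernelProfile_scaling N (by positivity)]
  -- The cutoff is antitone, so the kernel is nonnegative; it is not identically zero because the
  -- cutoff falls from 1 to 0. It can therefore be normalized.
  have hpos : 0 < ∫ z, ρ₀ z := by
    obtain ⟨s, hs⟩ := exists_deriv_cutoff_ne_zero
    have hs1 : 1 ≤ s := by
      by_contra! h
      exact hs (deriv_cutoff_of_lt_one h)
    obtain ⟨i⟩ := ‹Nonempty ι›
    refine hρ.continuous.integral_pos_of_hasCompactSupport_nonneg_nonzero hρc (fun z => ?_)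
      (x := EuclideanSpace.single i (Real.sqrt s)) ?_
    · have := antitone_cutoff.deriv_nonpos (x := ‖z‖ ^ 2)
      have h2 : 0 ≤ 2 * ‖z‖ ^ 2 * (‖z‖ ^ 2) ^ (-(N : ℝ) / 2) := by positivity
      simp only [ρ₀, kernelProfile, Pi.zero_apply]
      nlinarith
    · have e : ‖EuclideanSpace.single i (Real.sqrt s)‖ ^ 2 = s := by
        rw [PiLp.norm_single, Real.norm_eq_abs, sq_abs, Real.sq_sqrt (by linarith)]
      simp only [ρ₀]
      rw [e, kernelProfile]
      have : 0 < s ^ (-(N : ℝ) / 2) := Real.rpow_pos_of_pos (by linarith) _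
      have h0 : s ≠ 0 := by linarith
      simp [hs, this.ne', h0]
  set c := ∫ z, ρ₀ z
  refine ⟨fun z => c⁻¹ * ρ₀ z, fun j z => c⁻¹ * Ψ₀ j z, contDiff_const.mul hρ, hρc.mul_left, ?_,
    fun j => contDiff_const.mul (hΨ j), fun j => (hΨc j).mul_left, fun z => ?_⟩
  · rw [integral_const_mul]
    exact inv_mul_cancel₀ hpos.ne'
  · have : ∀ j, fderiv ℝ (fun z => c⁻¹ * Ψ₀ j z) z = c⁻¹ • fderiv ℝ (Ψ₀ j) z := fun j =>
      fderiv_const_mul ((hΨ j).differentiable (by simp) z) _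
    simp only [this, _root_.smul_apply, smul_eq_mul, ← Finset.mul_sum]
    rw [← hrel]
    ring

end Kernel

/-! ### Convolution bounds and their behaviour under dilation. -/

section Convolution

variable {ι : Type*} [Fintype ι] [DecidableEq ι]
variable {W : Type*} [NormedAddCommGroup W] [NormedSpace ℝ W]

/-- The convolution of a scalar kernel with a vector-valued function. -/
def kconv (k : EuclideanSpace ℝ ι → ℝ) (u : EuclideanSpace ℝ ι → W) : EuclideanSpace ℝ ι → W :=
  fun z => ∫ y, k (z - y) • u y

/-- The `L¹`-normalized dilate `z ↦ s ^ N k (s z)`. -/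
def dil (s : ℝ) (k : EuclideanSpace ℝ ι → ℝ) : EuclideanSpace ℝ ι → ℝ :=
  fun z => s ^ Fintype.card ι * k (s • z)

theorem kconv_eq_convolution (k : EuclideanSpace ℝ ι → ℝ) (u : EuclideanSpace ℝ ι → W) :
    kconv k u = convolution k u (ContinuousLinearMap.lsmul ℝ ℝ) volume := by
  funext z
  rw [convolution_lsmul_swap]
  rfl

theorem continuous_kconv {k : EuclideanSpace ℝ ι → ℝ} {u : EuclideanSpace ℝ ι → W}
    (hk : Continuous k) (hc : HasCompactSupport k) (hu : MemLp u 2 volume) :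
    Continuous (kconv k u) := by
  rw [kconv_eq_convolution]
  exact hc.continuous_convolution_left _ hk (hu.locallyIntegrable (by norm_num))

theorem eLpNorm_comp_sub_left {W' : Type*} [NormedAddCommGroup W'] {k : EuclideanSpace ℝ ι → W'}
    (hk : Continuous k) (z : EuclideanSpace ℝ ι) (q : ℝ≥0∞) :
    eLpNorm (fun y => k (z - y)) q volume = eLpNorm k q volume :=
  eLpNorm_comp_measurePreserving hk.aestronglyMeasurable (Measure.measurePreserving_sub_left volume z)

theorem memLp_comp_sub_left {k : EuclideanSpace ℝ ι → ℝ} (hk : Continuous k)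
    (hc : HasCompactSupport k) (z : EuclideanSpace ℝ ι) (q : ℝ≥0∞) :
    MemLp (fun y => k (z - y)) q volume :=
  (hk.memLp_of_hasCompactSupport hc).comp_measurePreserving (Measure.measurePreserving_sub_left volume z)

theorem enorm_kconv_le (k : EuclideanSpace ℝ ι → ℝ) (u : EuclideanSpace ℝ ι → W)
    (z : EuclideanSpace ℝ ι) : ‖kconv k u z‖ₑ ≤ ∫⁻ y, ‖k (z - y)‖ₑ * ‖u y‖ₑ :=
  (enorm_integral_le_lintegral_enorm _).trans_eq (by simp [enorm_smul])

theorem enorm_kconv_le_mul {k : EuclideanSpace ℝ ι → ℝ} {u : EuclideanSpace ℝ ι → W}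
    (hk : Continuous k) (hu : AEStronglyMeasurable u volume) (z : EuclideanSpace ℝ ι) :
    ‖kconv k u z‖ₑ ≤ eLpNorm k 2 volume * eLpNorm u 2 volume := by
  rw [← eLpNorm_comp_sub_left hk z]
  refine (enorm_integral_le_lintegral_enorm _).trans ?_
  rw [← eLpNorm_one_eq_lintegral_enorm]
  exact eLpNorm_smul_le_mul_eLpNorm (p := 2) (q := 2) (r := 1) hu
    (hk.comp (continuous_const.sub continuous_id)).aestronglyMeasurable

theorem eLpNorm_two_sq {X : Type*} [MeasurableSpace X] {μ : Measure X} {W' : Type*}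
    [NormedAddCommGroup W'] (f : X → W') : eLpNorm f 2 μ ^ 2 = ∫⁻ x, ‖f x‖ₑ ^ 2 ∂μ := by
  rw [eLpNorm_eq_lintegral_rpow_enorm_toReal (by simp) (by simp), ← ENNReal.rpow_natCast,
    ← ENNReal.rpow_mul]
  simp

/-- Young's inequality: Cauchy–Schwarz with `|k| = |k|^(1/2) |k|^(1/2)` bounds the square pointwise,
and Tonelli integrates it. -/
theorem eLpNorm_kconv_two_le {k : EuclideanSpace ℝ ι → ℝ} {u : EuclideanSpace ℝ ι → W}
    (hk : Continuous k) (hu : AEStronglyMeasurable u volume) :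
    eLpNorm (kconv k u) 2 volume ≤ eLpNorm k 1 volume * eLpNorm u 2 volume := by
  have hmk : ∀ z, AEMeasurable (fun y => ‖k (z - y)‖ₑ) volume := fun z =>
    (hk.comp (continuous_const.sub continuous_id)).enorm.aemeasurable
  have hmu : AEMeasurable (fun y => ‖u y‖ₑ) volume := hu.enorm
  have hpt : ∀ z, ‖kconv k u z‖ₑ ^ 2 ≤
      eLpNorm k 1 volume * ∫⁻ y, ‖k (z - y)‖ₑ * ‖u y‖ₑ ^ 2 := by
    intro z
    have h1 := ENNReal.lintegral_mul_le_Lp_mul_Lq volume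
      (show (2 : ℝ).HolderConjugate 2 by constructor <;> norm_num)
      (f := fun y => ‖k (z - y)‖ₑ ^ (1 / 2 : ℝ)) (g := fun y => ‖k (z - y)‖ₑ ^ (1 / 2 : ℝ) * ‖u y‖ₑ)
      ((hmk z).pow_const _) (((hmk z).pow_const _).mul hmu)
    have e1 : ∀ y, ‖k (z - y)‖ₑ ^ (1 / 2 : ℝ) * (‖k (z - y)‖ₑ ^ (1 / 2 : ℝ) * ‖u y‖ₑ) =
        ‖k (z - y)‖ₑ * ‖u y‖ₑ := by
      intro y
      rw [← mul_assoc, ← ENNReal.rpow_add_of_nonneg _ _ (by norm_num) (by norm_num)]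
      norm_num
    have e2 : ∀ y, (‖k (z - y)‖ₑ ^ (1 / 2 : ℝ)) ^ (2 : ℝ) = ‖k (z - y)‖ₑ := by
      intro y
      rw [← ENNReal.rpow_mul]
      norm_num
    have e3 : ∀ y, (‖k (z - y)‖ₑ ^ (1 / 2 : ℝ) * ‖u y‖ₑ) ^ (2 : ℝ) =
        ‖k (z - y)‖ₑ * ‖u y‖ₑ ^ 2 := by
      intro y
      rw [ENNReal.mul_rpow_of_nonneg _ _ (by norm_num), e2, ENNReal.rpow_ofNat]
    simp only [Pi.mul_apply, e1, e2, e3] at h1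
    have h2 := (enorm_kconv_le k u z).trans h1
    have e4 : ∫⁻ y, ‖k (z - y)‖ₑ = eLpNorm k 1 volume := by
      rw [← eLpNorm_one_eq_lintegral_enorm, eLpNorm_comp_sub_left hk]
    rw [e4] at h2
    calc ‖kconv k u z‖ₑ ^ 2 ≤ _ := pow_le_pow_left' h2 2
      _ = _ := by
        rw [mul_pow, ← ENNReal.rpow_natCast, ← ENNReal.rpow_natCast, ← ENNReal.rpow_mul,
          ← ENNReal.rpow_mul]
        norm_num
  rw [← ENNReal.pow_le_pow_left_iff (n := 2) two_ne_zero, eLpNorm_two_sq, mul_pow]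
  calc ∫⁻ z, ‖kconv k u z‖ₑ ^ 2
      ≤ ∫⁻ z, eLpNorm k 1 volume * ∫⁻ y, ‖k (z - y)‖ₑ * ‖u y‖ₑ ^ 2 := lintegral_mono hpt
    _ = eLpNorm k 1 volume * ∫⁻ z, ∫⁻ y, ‖k (z - y)‖ₑ * ‖u y‖ₑ ^ 2 := by
        rw [lintegral_const_mul'']
        refine AEMeasurable.lintegral_prod_right' (ν := volume) (f := fun p : EuclideanSpace ℝ ι ×
          EuclideanSpace ℝ ι => ‖k (p.1 - p.2)‖ₑ * ‖u p.2‖ₑ ^ 2) ?_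
        exact (hk.comp (continuous_fst.sub continuous_snd)).enorm.aemeasurable.mul
          ((hmu.comp_quasiMeasurePreserving Measure.quasiMeasurePreserving_snd).pow_const 2)
    _ = eLpNorm k 1 volume * ∫⁻ y, ∫⁻ z, ‖k (z - y)‖ₑ * ‖u y‖ₑ ^ 2 := by
        congr 1
        refine lintegral_lintegral_swap ?_
        exact (hk.comp (continuous_fst.sub continuous_snd)).enorm.aemeasurable.mul
          ((hmu.comp_quasiMeasurePreserving Measure.quasiMeasurePreserving_snd).pow_const 2)
    _ = eLpNorm k 1 volume * ∫⁻ y, eLpNorm k 1 volume * ‖u y‖ₑ ^ 2 := by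
        congr 1
        refine lintegral_congr fun y => ?_
        have hm : AEMeasurable (fun z => ‖k (z - y)‖ₑ) volume :=
          (hk.comp (continuous_id.sub continuous_const)).enorm.aemeasurable
        rw [lintegral_mul_const'' _ hm,
          lintegral_sub_right_eq_self (fun z => ‖k z‖ₑ) y, ← eLpNorm_one_eq_lintegral_enorm]
    _ = eLpNorm k 1 volume ^ 2 * eLpNorm u 2 volume ^ 2 := by
        rw [lintegral_const_mul'' _ (hmu.pow_const 2), eLpNorm_two_sq]
        ring

/-- Interpolation between `L^∞` and `L²`. -/
theorem eLpNorm_le_rpow_mul_rpow {X : Type*} [MeasurableSpace X] {μ : Measure X} {W' : Type*}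
    [NormedAddCommGroup W'] {g : X → W'} (hg : AEStronglyMeasurable g μ) {S : ℝ≥0∞}
    (hS : ∀ x, ‖g x‖ₑ ≤ S) {q : ℝ} (hq : 2 ≤ q) :
    eLpNorm g (ENNReal.ofReal q) μ ≤ S ^ ((q - 2) / q) * eLpNorm g 2 μ ^ (2 / q) := by
  have hq0 : 0 < q := by linarith
  rw [eLpNorm_eq_lintegral_rpow_enorm_toReal (by simpa using hq0) (by simp),
    ENNReal.toReal_ofReal hq0.le]
  have h1 : ∫⁻ x, ‖g x‖ₑ ^ q ∂μ ≤ S ^ (q - 2) * eLpNorm g 2 μ ^ 2 := by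
    rw [eLpNorm_two_sq, ← lintegral_const_mul'' _ (hg.enorm.pow_const 2)]
    refine lintegral_mono fun x => ?_
    calc ‖g x‖ₑ ^ q = ‖g x‖ₑ ^ (q - 2) * ‖g x‖ₑ ^ (2 : ℝ) := by
          rw [← ENNReal.rpow_add_of_nonneg _ _ (by linarith) (by norm_num)]
          congr 1
          ring
      _ ≤ S ^ (q - 2) * ‖g x‖ₑ ^ 2 := by
          rw [ENNReal.rpow_ofNat]
          exact mul_le_mul_left (ENNReal.rpow_le_rpow (hS x) (by linarith)) _
  calc _ ≤ (S ^ (q - 2) * eLpNorm g 2 μ ^ 2) ^ (1 / q) := by gcongr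
    _ = _ := by
      rw [ENNReal.mul_rpow_of_nonneg _ _ (by positivity), ← ENNReal.rpow_mul,
        ← ENNReal.rpow_natCast, ← ENNReal.rpow_mul]
      congr 2 <;> simp <;> ring

/-- Interpolates between the sup bound by `‖k‖₂ ‖u‖₂` and the `L²` bound by `‖k‖₁ ‖u‖₂`; the
exponents add up to 1, so the norm of `u` appears linearly. -/
theorem eLpNorm_kconv_le {k : EuclideanSpace ℝ ι → ℝ} {u : EuclideanSpace ℝ ι → W}
    (hk : Continuous k) (hc : HasCompactSupport k) (hu : MemLp u 2 volume) {q : ℝ} (hq : 2 ≤ q) :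
    eLpNorm (kconv k u) (ENNReal.ofReal q) volume ≤
      eLpNorm k 2 volume ^ ((q - 2) / q) * eLpNorm k 1 volume ^ (2 / q) *
        eLpNorm u 2 volume := by
  have hq0 : 0 < q := by linarith
  have h0 : 0 ≤ (q - 2) / q := div_nonneg (by linarith) hq0.le
  have h1 : 0 ≤ 2 / q := by positivity
  refine (eLpNorm_le_rpow_mul_rpow (continuous_kconv hk hc hu).aestronglyMeasurable
    (enorm_kconv_le_mul hk hu.1) hq).trans ?_
  calc _ ≤ (eLpNorm k 2 volume * eLpNorm u 2 volume) ^ ((q - 2) / q) *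
        (eLpNorm k 1 volume * eLpNorm u 2 volume) ^ (2 / q) := by
        gcongr
        exact eLpNorm_kconv_two_le hk hu.1
    _ = eLpNorm k 2 volume ^ ((q - 2) / q) * eLpNorm k 1 volume ^ (2 / q) *
        (eLpNorm u 2 volume ^ ((q - 2) / q) * eLpNorm u 2 volume ^ (2 / q)) := by
        rw [ENNReal.mul_rpow_of_nonneg _ _ h0, ENNReal.mul_rpow_of_nonneg _ _ h1]
        ring
    _ = _ := by
        rw [← ENNReal.rpow_add_of_nonneg _ _ h0 h1, ← add_div, sub_add_cancel, div_self hq0.ne',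
          ENNReal.rpow_one]

theorem continuous_dil {k : EuclideanSpace ℝ ι → ℝ} (hk : Continuous k) (s : ℝ) :
    Continuous (dil s k) :=
  continuous_const.mul (hk.comp (continuous_const_smul s))

theorem hasCompactSupport_dil {k : EuclideanSpace ℝ ι → ℝ} (hc : HasCompactSupport k) {s : ℝ}
    (hs : s ≠ 0) : HasCompactSupport (dil s k) :=
  (hc.comp_homeomorph (Homeomorph.smulOfNeZero s hs)).mul_left

theorem eLpNorm_dil {k : EuclideanSpace ℝ ι → ℝ} (hk : Continuous k) {s : ℝ} (hs : 0 < s)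
    {q : ℝ} (hq : 1 ≤ q) :
    eLpNorm (dil s k) (ENNReal.ofReal q) volume =
      ENNReal.ofReal (s ^ (Fintype.card ι * (1 - 1 / q))) *
        eLpNorm k (ENNReal.ofReal q) volume := by
  have hq0 : 0 < q := by linarith
  have hm := Measure.map_addHaar_smul (volume : Measure (EuclideanSpace ℝ ι)) hs.ne'
  have h1 : eLpNorm (fun z => k (s • z)) (ENNReal.ofReal q) volume =
      ENNReal.ofReal (s ^ (-(Fintype.card ι : ℝ) / q)) * eLpNorm k (ENNReal.ofReal q) volume := by
    have := eLpNorm_map_measure (μ := (volume : Measure (EuclideanSpace ℝ ι))) (g := k)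
      (f := fun z => s • z) (p := ENNReal.ofReal q) hk.aestronglyMeasurable
      (continuous_const_smul s).measurable.aemeasurable
    rw [hm, eLpNorm_smul_measure_of_ne_top (by simp)] at this
    rw [show (fun z => k (s • z)) = k ∘ (fun z => s • z) from rfl, ← this, smul_eq_mul]
    congr 1
    rw [one_div, ENNReal.toReal_inv, ENNReal.toReal_ofReal hq0.le,
      ENNReal.ofReal_rpow_of_nonneg (by positivity) (by positivity), finrank_euclideanSpace,
      abs_of_nonneg (by positivity), ← Real.rpow_natCast, ← Real.rpow_neg hs.le,
      ← Real.rpow_mul hs.le]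
    congr 2
  have h2 : dil s k = (s ^ Fintype.card ι) • fun z => k (s • z) := rfl
  rw [h2, eLpNorm_const_smul, h1, ← mul_assoc, Real.enorm_eq_ofReal (by positivity),
    ← ENNReal.ofReal_mul (by positivity), ← Real.rpow_natCast, ← Real.rpow_add hs]
  congr 3
  ring

/-- Dilation by `s` keeps the `L¹` norm of the kernel and multiplies its `L²` norm by `s^(N/2)`,
which enters to the power `(q - 2)/q`. In the subcritical range the resulting growth per dyadic step
is less than 2. -/
theorem exists_eLpNorm_kconv_dil_le {k : EuclideanSpace ℝ ι → ℝ} (hk : Continuous k)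
    (hc : HasCompactSupport k) {q : ℝ} (hq : 2 ≤ q) :
    ∃ C : ℝ≥0∞, C ≠ ⊤ ∧ ∀ (m : ℕ) (u : EuclideanSpace ℝ ι → W), MemLp u 2 volume →
      eLpNorm (kconv (dil (2 ^ m) k) u) (ENNReal.ofReal q) volume ≤
        C * ENNReal.ofReal (2 ^ (Fintype.card ι * (q - 2) / (2 * q))) ^ m *
          eLpNorm u 2 volume := by
  have hq0 : 0 < q := by linarith
  have h0 : 0 ≤ (q - 2) / q := div_nonneg (by linarith) hq0.le
  have h1 : 0 ≤ 2 / q := by positivity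
  refine ⟨eLpNorm k 2 volume ^ ((q - 2) / q) * eLpNorm k 1 volume ^ (2 / q), ?_, fun m u hu => ?_⟩
  · exact ENNReal.mul_ne_top
      (ENNReal.rpow_ne_top_of_nonneg h0 (hk.memLp_of_hasCompactSupport hc).2.ne)
      (ENNReal.rpow_ne_top_of_nonneg h1 (hk.memLp_of_hasCompactSupport hc).2.ne)
  · have hs : (0 : ℝ) < 2 ^ m := by positivity
    refine (eLpNorm_kconv_le (continuous_dil hk _) (hasCompactSupport_dil hc hs.ne') hu
      hq).trans_eq ?_
    have e1 := eLpNorm_dil hk hs (le_refl 1)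
    have e2 := eLpNorm_dil hk hs (q := 2) (by norm_num)
    rw [ENNReal.ofReal_one] at e1
    rw [show ENNReal.ofReal 2 = 2 by simp] at e2
    rw [e1, e2, ENNReal.mul_rpow_of_nonneg _ _ h0, ENNReal.ofReal_rpow_of_nonneg (by positivity) h0,
      ← ENNReal.ofReal_pow (by positivity), ← Real.rpow_natCast, ← Real.rpow_natCast,
      ← Real.rpow_mul (by norm_num), ← Real.rpow_mul (by norm_num), ← Real.rpow_mul (by norm_num)]
    norm_num
    rw [show (m : ℝ) * (Fintype.card ι * (1 / 2) * ((q - 2) / q)) =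
      Fintype.card ι * (q - 2) / (2 * q) * m by field_simp, Real.rpow_mul (by norm_num),
      Real.rpow_natCast]
    ring

end Convolution

/-! ### Approximation of `H¹` functions by dyadic averages. -/

section Smoothing

variable {ι : Type*} [Fintype ι] [DecidableEq ι]
variable {V : Type*} [NormedAddCommGroup V] [InnerProductSpace ℂ V]

/-- Consecutive dyadic averages of `u` differ by averages of the weak partial derivatives. -/
theorem kconv_dil_succ_sub {ρ : EuclideanSpace ℝ ι → ℝ} {Ψ : ι → EuclideanSpace ℝ ι → ℝ}
    (hρ : Continuous ρ) (hρc : HasCompactSupport ρ) (hΨ : ∀ j, ContDiff ℝ ∞ (Ψ j))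
    (hΨc : ∀ j, HasCompactSupport (Ψ j))
    (hrel : ∀ z, 2 ^ Fintype.card ι * ρ ((2 : ℝ) • z) - ρ z =
      ∑ j, fderiv ℝ (Ψ j) z (EuclideanSpace.single j 1))
    {u : EuclideanSpace ℝ ι → V} (hu : MemH1 u) (m : ℕ) :
    kconv (dil (2 ^ (m + 1)) ρ) u - kconv (dil (2 ^ m) ρ) u =
      ∑ j, ((2 : ℝ) ^ m)⁻¹ • kconv (dil (2 ^ m) (Ψ j)) (weakPartial j u) := by
  funext z
  set s : ℝ := 2 ^ m with hs
  have hs0 : s ≠ 0 := by positivity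
  -- The test functions for the weak derivatives. The factor `s⁻¹` cancels the `s` produced by
  -- differentiating the dilate, and is the gain `2^(-m)` in the conclusion.
  let φ : ι → EuclideanSpace ℝ ι → ℝ := fun j y => s⁻¹ * dil s (Ψ j) (z - y)
  have hφ : ∀ j, ContDiff ℝ ∞ (φ j) := fun j => contDiff_const.mul (contDiff_const.mul
    ((hΨ j).comp (ContDiff.const_smul s (contDiff_const.sub contDiff_id))))
  have hφc : ∀ j, HasCompactSupport (φ j) := fun j => HasCompactSupport.mul_left
    ((hasCompactSupport_dil (hΨc j) hs0).comp_homeomorph (Homeomorph.subLeft z))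
  have hd : ∀ j y, fderiv ℝ (φ j) y (EuclideanSpace.single j 1) =
      -(s ^ Fintype.card ι * fderiv ℝ (Ψ j) (s • (z - y)) (EuclideanSpace.single j 1)) := by
    intro j y
    have h1 : HasFDerivAt (fun y : EuclideanSpace ℝ ι => s • (z - y))
        (s • (-ContinuousLinearMap.id ℝ (EuclideanSpace ℝ ι))) y :=
      ((hasFDerivAt_id y).const_sub z).const_smul s
    have h2 := (((hΨ j).differentiable (by simp) (s • (z - y))).hasFDerivAt.comp y h1).const_mul
      (s ^ Fintype.card ι) |>.const_mul s⁻¹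
    have h3 : fderiv ℝ (φ j) y = _ := h2.fderiv
    rw [h3]
    simp
    field_simp
  have ha : ∀ t : ℝ, t ≠ 0 → Integrable (fun y => dil t ρ (z - y) • u y) volume := fun t ht =>
    integrable_smul_of_memLp_two
      (memLp_comp_sub_left (continuous_dil hρ t) (hasCompactSupport_dil hρc ht) z 2) hu.1
  have hkey : ∀ y, dil (2 ^ (m + 1)) ρ (z - y) - dil s ρ (z - y) =
      -∑ j, fderiv ℝ (φ j) y (EuclideanSpace.single j 1) := by
    intro y
    simp only [hd, Finset.sum_neg_distrib, neg_neg, ← Finset.mul_sum]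
    rw [← hrel, dil, dil, smul_smul, pow_succ, ← hs, mul_comm s 2, mul_pow]
    ring
  have h1 : (kconv (dil (2 ^ (m + 1)) ρ) u - kconv (dil s ρ) u) z =
      -∑ j, ∫ y, fderiv ℝ (φ j) y (EuclideanSpace.single j 1) • u y := by
    rw [← integral_finsetSum _ fun j _ => integrable_smul_of_memLp_two
      (memLp_fderiv_apply (hφ j) (hφc j) _ 2) hu.1, ← integral_neg]
    simp only [Pi.sub_apply, kconv]
    rw [← integral_sub (ha _ (by positivity)) (ha _ hs0)]
    refine integral_congr_ae (Eventually.of_forall fun y => ?_)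
    simp only []
    rw [← sub_smul, hkey, neg_smul, Finset.sum_smul]
  rw [h1, ← Finset.sum_neg_distrib, Finset.sum_apply]
  refine Finset.sum_congr rfl fun j _ => ?_
  rw [hu.isWeakPartial j _ (hφ j) (hφc j), neg_neg, Pi.smul_apply, kconv, ← integral_smul]
  simp only [φ, mul_smul]

/-- Dyadic averages converge almost everywhere. -/
theorem ae_tendsto_kconv_dil [CompleteSpace V] {ρ : EuclideanSpace ℝ ι → ℝ}
    (hρ : Continuous ρ) (hρc : HasCompactSupport ρ) (h1 : ∫ z, ρ z = 1)
    {u : EuclideanSpace ℝ ι → V} (hu : LocallyIntegrable u volume) :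
    ∀ᵐ z, Tendsto (fun m : ℕ => kconv (dil (2 ^ m) ρ) u z) atTop (𝓝 (u z)) := by
  obtain ⟨R, hR0, hR⟩ : ∃ R : ℝ, 0 < R ∧ ∀ z, R < ‖z‖ → ρ z = 0 := by
    obtain ⟨R, hR⟩ := hρc.isBounded.subset_closedBall (0 : EuclideanSpace ℝ ι)
    refine ⟨max R 1, by positivity, fun z hz => ?_⟩
    by_contra h
    have := hR (subset_tsupport _ h)
    rw [mem_closedBall_zero_iff] at this
    exact absurd (lt_of_le_of_lt (le_max_left R 1) hz) (not_lt.2 this)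
  obtain ⟨B, hB⟩ := hρ.bounded_above_of_compact_support hρc
  -- Convergence is proved at Lebesgue points: the dilated kernels live on balls shrinking to `z`,
  -- have integral 1, and are bounded by a constant over the volume of the ball.
  filter_upwards [(Besicovitch.vitaliFamily volume).ae_tendsto_average_norm_sub hu] with z hz
  have hr : Tendsto (fun m : ℕ => R * ((2 : ℝ) ^ m)⁻¹) atTop (𝓝[>] 0) := by
    refine tendsto_nhdsWithin_iff.2 ⟨?_, Eventually.of_forall fun m => by
      simp only [Set.mem_Ioi]; positivity⟩
    have := (tendsto_pow_atTop_nhds_zero_of_lt_one (r := (1 / 2 : ℝ)) (by norm_num)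
      (by norm_num)).const_mul R
    simpa using this
  have ht := (hz.comp (Besicovitch.tendsto_filterAt volume z)).comp hr
  refine tendsto_integral_smul_of_tendsto_average_norm_sub
    (a := fun m : ℕ => Metric.closedBall z (R * ((2 : ℝ) ^ m)⁻¹))
    (g := fun m y => dil (2 ^ m) ρ (z - y))
    (B * volume.real (Metric.closedBall (0 : EuclideanSpace ℝ ι) R)) ht ?_ ?_ ?_ ?_
  · exact Eventually.of_forall fun m => hu.integrableOn_isCompact (isCompact_closedBall _ _)
  · refine tendsto_const_nhds.congr fun m => ?_
    rw [integral_sub_left_eq_self (dil (2 ^ m) ρ) volume z]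
    simp only [dil]
    rw [integral_const_mul, Measure.integral_comp_smul, h1, finrank_euclideanSpace,
      abs_of_nonneg (by positivity)]
    simp
  · refine Eventually.of_forall fun m y hy => ?_
    rw [Metric.mem_closedBall, dist_comm, dist_eq_norm]
    by_contra! h
    refine hy ?_
    have : R < ‖(2 : ℝ) ^ m • (z - y)‖ := by
      rw [norm_smul, norm_pow, Real.norm_ofNat]
      rwa [← div_eq_mul_inv, div_lt_iff₀' (by positivity)] at h
    simp [dil, hR _ this]
  · refine Eventually.of_forall fun m y => ?_
    have hv : volume.real (Metric.closedBall (0 : EuclideanSpace ℝ ι) R) =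
        (2 ^ m) ^ Fintype.card ι *
          volume.real (Metric.closedBall z (R * ((2 : ℝ) ^ m)⁻¹)) := by
      have e := Measure.addHaar_real_closedBall (volume : Measure (EuclideanSpace ℝ ι))
        (0 : EuclideanSpace ℝ ι) hR0.le
      have e' := Measure.addHaar_real_closedBall (volume : Measure (EuclideanSpace ℝ ι)) z
        (show 0 ≤ R * ((2 : ℝ) ^ m)⁻¹ by positivity)
      rw [e, e', finrank_euclideanSpace, mul_pow, inv_pow]
      field_simp
    have hpos : 0 < volume.real (Metric.closedBall z (R * ((2 : ℝ) ^ m)⁻¹)) := by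
      refine ENNReal.toReal_pos (Metric.measure_closedBall_pos _ _ (by positivity)).ne'
        measure_closedBall_lt_top.ne
    rw [hv, le_div_iff₀ hpos, dil, abs_mul, abs_of_nonneg (by positivity)]
    have := hB ((2 : ℝ) ^ m • (z - y))
    rw [Real.norm_eq_abs] at this
    calc _ = |ρ ((2 : ℝ) ^ m • (z - y))| * ((2 ^ m) ^ Fintype.card ι *
          volume.real (Metric.closedBall z (R * ((2 : ℝ) ^ m)⁻¹))) := by ring
      _ ≤ _ := by gcongr

/-- Averages approximate `H¹` functions in all subcritical Lebesgue norms, at a geometric rate. -/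
theorem exists_smoothing_kernels [Nonempty ι] [FiniteDimensional ℂ V] :
    ∃ a : ℕ → EuclideanSpace ℝ ι → ℝ, (∀ m, Continuous (a m)) ∧ (∀ m, HasCompactSupport (a m)) ∧
      ∀ q : ℝ, 2 ≤ q → Fintype.card ι * (q - 2) < 2 * q →
        ∃ C θ : ℝ≥0∞, C ≠ ⊤ ∧ θ < 1 ∧ ∀ (u : EuclideanSpace ℝ ι → V), MemH1 u → ∀ m,
          eLpNorm (u - kconv (a m) u) (ENNReal.ofReal q) volume ≤
            C * θ ^ m * ENNReal.ofReal (h1Norm u) := by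
  have : CompleteSpace V := FiniteDimensional.complete ℂ V
  obtain ⟨ρ, Ψ, hρ, hρc, h1, hΨ, hΨc, hrel⟩ := exists_averaging_kernel (ι := ι)
  have hac : ∀ m : ℕ, Continuous (dil (2 ^ m) ρ) := fun m => continuous_dil hρ.continuous _
  have has : ∀ m : ℕ, HasCompactSupport (dil (2 ^ m) ρ) := fun m =>
    hasCompactSupport_dil hρc (by positivity)
  refine ⟨fun m => dil (2 ^ m) ρ, hac, has, fun q hq hqN => ?_⟩
  have hq0 : 0 < q := by linarith
  have hq1 : 1 ≤ ENNReal.ofReal q := by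
    rw [← ENNReal.ofReal_one]
    exact ENNReal.ofReal_le_ofReal (by linarith)
  choose C hC hCk using fun j => exists_eLpNorm_kconv_dil_le (W := V) (hΨ j).continuous (hΨc j) hq
  set γ : ℝ := Fintype.card ι * (q - 2) / (2 * q) with hγ
  -- Subcriticality enters here: the growth `2^(γ m)` of the convolution norms is beaten by the
  -- factor `2^(-m)`.
  have hγ1 : γ < 1 := by rw [hγ, div_lt_one (by positivity)]; exact hqN
  set θ : ℝ≥0∞ := ENNReal.ofReal (2 ^ (γ - 1)) with hθ
  have hθ1 : θ < 1 := by
    rw [hθ, ENNReal.ofReal_lt_one]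
    exact Real.rpow_lt_one_of_one_lt_of_neg (by norm_num) (by linarith)
  have hθm : ∀ m : ℕ, ENNReal.ofReal (((2 : ℝ) ^ m)⁻¹) * ENNReal.ofReal (2 ^ γ) ^ m = θ ^ m := by
    intro m
    rw [← inv_pow, ENNReal.ofReal_pow (by norm_num), ← mul_pow, ← ENNReal.ofReal_mul (by norm_num),
      hθ, Real.rpow_sub_one (by norm_num)]
    congr 2
    ring
  refine ⟨(∑ j, C j) * (1 - θ)⁻¹, θ, ENNReal.mul_ne_top (ENNReal.sum_ne_top.2 fun j _ => hC j)
    (ENNReal.inv_ne_top.2 (tsub_pos_of_lt hθ1).ne'), hθ1, fun u hu m => ?_⟩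
  set D := ENNReal.ofReal (h1Norm u)
  have hmeas : ∀ m : ℕ, AEStronglyMeasurable (kconv (dil (2 ^ m) ρ) u) volume := fun m =>
    (continuous_kconv (hac m) (has m) hu.1).aestronglyMeasurable
  have hstep : ∀ m : ℕ, eLpNorm (kconv (dil (2 ^ (m + 1)) ρ) u - kconv (dil (2 ^ m) ρ) u)
      (ENNReal.ofReal q) volume ≤ (∑ j, C j) * θ ^ m * D := by
    intro m
    rw [kconv_dil_succ_sub hρ.continuous hρc hΨ hΨc hrel hu m]
    refine (eLpNorm_sum_le (fun j _ => ((continuous_kconv (continuous_dil (hΨ j).continuous _)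
      (hasCompactSupport_dil (hΨc j) (by positivity))
      (hu.memLp_weakPartial j)).aestronglyMeasurable).const_smul _) hq1).trans ?_
    rw [Finset.sum_mul, Finset.sum_mul]
    refine Finset.sum_le_sum fun j _ => ?_
    rw [eLpNorm_const_smul, Real.enorm_eq_ofReal (by positivity)]
    calc _ ≤ ENNReal.ofReal (((2 : ℝ) ^ m)⁻¹) * (C j * ENNReal.ofReal (2 ^ γ) ^ m * D) := by
          gcongr
          refine (hCk j m _ (hu.memLp_weakPartial j)).trans ?_
          gcongr
          exact hu.eLpNorm_weakPartial_le j
      _ = C j * θ ^ m * D := by rw [← hθm]; ring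
  have htel : ∀ k : ℕ, eLpNorm (kconv (dil (2 ^ (m + k)) ρ) u - kconv (dil (2 ^ m) ρ) u)
      (ENNReal.ofReal q) volume ≤ ∑ i ∈ Finset.range k, (∑ j, C j) * θ ^ (m + i) * D := by
    intro k
    induction k with
    | zero => simp
    | succ k ih =>
      rw [Finset.sum_range_succ, ← sub_add_sub_cancel' (kconv (dil (2 ^ (m + k)) ρ) u)]
      refine (eLpNorm_add_le ((hmeas _).sub (hmeas _)) ((hmeas _).sub (hmeas _)) hq1).trans ?_
      exact add_le_add ih (hstep (m + k))
  have hsum : ∀ k : ℕ, ∑ i ∈ Finset.range k, (∑ j, C j) * θ ^ (m + i) * D ≤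
      (∑ j, C j) * (1 - θ)⁻¹ * θ ^ m * D := by
    intro k
    rw [← ENNReal.tsum_geometric θ]
    calc _ = (∑ j, C j) * (∑ i ∈ Finset.range k, θ ^ i) * θ ^ m * D := by
          rw [Finset.mul_sum, Finset.sum_mul, Finset.sum_mul]
          exact Finset.sum_congr rfl fun i _ => by rw [pow_add]; ring
      _ ≤ _ := by
          gcongr
          exact ENNReal.sum_le_tsum _
  have hlim : ∀ᵐ z, Tendsto (fun k : ℕ => (kconv (dil (2 ^ (m + k)) ρ) u -
      kconv (dil (2 ^ m) ρ) u) z) atTop (𝓝 ((u - kconv (dil (2 ^ m) ρ) u) z)) := by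
    filter_upwards [ae_tendsto_kconv_dil hρ.continuous hρc h1
      (hu.1.locallyIntegrable (by norm_num))] with z hz
    have := (hz.comp (tendsto_add_atTop_nat m)).sub_const (kconv (dil (2 ^ m) ρ) u z)
    simpa [Function.comp_def, add_comm] using this
  -- Fatou's lemma carries the uniform telescoping bound over to the almost everywhere limit.
  refine (Lp.eLpNorm_lim_le_liminf_eLpNorm (fun k => (hmeas _).sub (hmeas _)) _ hlim).trans ?_
  refine liminf_le_of_le (by isBoundedDefault) fun b hb => ?_
  obtain ⟨k, hk⟩ := hb.exists
  exact hk.trans ((htel k).trans (hsum k))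

end Smoothing

/-! ### Sobolev inequality, non-vanishing, and local compactness. -/

section Compactness

attribute [local instance] InnerProductSpace.complexToReal

variable {ι : Type*} [Fintype ι] [DecidableEq ι]
variable {V : Type*} [NormedAddCommGroup V] [InnerProductSpace ℂ V]

/-- The subcritical Sobolev inequality. -/
theorem exists_sobolev_const [Nonempty ι] [FiniteDimensional ℂ V] {q : ℝ} (hq : 2 ≤ q)
    (hqN : Fintype.card ι * (q - 2) < 2 * q) :
    ∃ C : ℝ≥0∞, C ≠ ⊤ ∧ ∀ u : EuclideanSpace ℝ ι → V, MemH1 u →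
      eLpNorm u (ENNReal.ofReal q) volume ≤ C * ENNReal.ofReal (h1Norm u) := by
  obtain ⟨a, ha, hac, h⟩ := exists_smoothing_kernels (ι := ι) (V := V)
  obtain ⟨C, θ, hC, hθ, hCu⟩ := h q hq hqN
  have hq0 : 0 < q := by linarith
  have hq1 : 1 ≤ ENNReal.ofReal q := by
    rw [← ENNReal.ofReal_one]
    exact ENNReal.ofReal_le_ofReal (by linarith)
  set K := eLpNorm (a 0) 2 volume ^ ((q - 2) / q) * eLpNorm (a 0) 1 volume ^ (2 / q)
  have hK : K ≠ ⊤ := ENNReal.mul_ne_top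
    (ENNReal.rpow_ne_top_of_nonneg (div_nonneg (by linarith) hq0.le)
      ((ha 0).memLp_of_hasCompactSupport (hac 0)).2.ne)
    (ENNReal.rpow_ne_top_of_nonneg (by positivity)
      ((ha 0).memLp_of_hasCompactSupport (hac 0)).2.ne)
  refine ⟨C + K, ENNReal.add_ne_top.2 ⟨hC, hK⟩, fun u hu => ?_⟩
  have hm := (continuous_kconv (ha 0) (hac 0) hu.1).aestronglyMeasurable (μ := volume)
  calc eLpNorm u (ENNReal.ofReal q) volume
      = eLpNorm (u - kconv (a 0) u + kconv (a 0) u) (ENNReal.ofReal q) volume := by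
        rw [sub_add_cancel]
    _ ≤ _ := eLpNorm_add_le (hu.1.1.sub hm) hm hq1
    _ ≤ C * ENNReal.ofReal (h1Norm u) + K * ENNReal.ofReal (h1Norm u) := by
        refine add_le_add (by simpa using hCu u hu 0)
          ((eLpNorm_kconv_le (ha 0) (hac 0) hu.1 hq).trans ?_)
        gcongr
        exact hu.eLpNorm_le
    _ = _ := by ring

theorem exists_pos_rpow_mul_lt {α : ℝ} (hα : 0 < α) {K ε : ℝ≥0∞} (hK : K ≠ ⊤) (hε : 0 < ε) :
    ∃ σ : ℝ≥0∞, 0 < σ ∧ σ ^ α * K < ε := by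
  have h1 : Tendsto (fun σ : ℝ≥0∞ => σ ^ α) (𝓝 0) (𝓝 0) := by
    simpa [hα] using (ENNReal.continuous_rpow_const (y := α)).tendsto 0
  have h2 : Tendsto (fun σ : ℝ≥0∞ => σ ^ α * K) (𝓝 0) (𝓝 0) := by
    simpa using ENNReal.Tendsto.mul_const h1 (Or.inr hK)
  have h3 := (h2.eventually (gt_mem_nhds hε)).filter_mono (nhdsWithin_le_nhds (s := Set.Ioi 0))
  obtain ⟨σ, hσ, hσ0⟩ := (h3.and self_mem_nhdsWithin).exists
  exact ⟨σ, hσ0, hσ⟩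

/-- A bounded set of `H¹` functions whose subcritical norms are bounded below does not vanish:
each of them has a fixed amount of mass on some ball of fixed radius. -/
theorem exists_ball_mass [Nonempty ι] [FiniteDimensional ℂ V] {q : ℝ} (hq : 2 < q)
    (hqN : Fintype.card ι * (q - 2) < 2 * q) (M : ℝ) {b : ℝ≥0∞} (hb : 0 < b) :
    ∃ (c : ℝ≥0∞) (r : ℝ), 0 < c ∧ 0 < r ∧ ∀ u : EuclideanSpace ℝ ι → V, MemH1 u →
      h1Norm u ≤ M → b ≤ eLpNorm u (ENNReal.ofReal q) volume →
      ∃ z, c ≤ ∫⁻ y in Metric.closedBall z r, ‖u y‖ₑ ^ 2 := by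
  obtain ⟨a, ha, hac, h⟩ := exists_smoothing_kernels (ι := ι) (V := V)
  obtain ⟨C, θ, hC, hθ, hCu⟩ := h q hq.le hqN
  have hq0 : 0 < q := by linarith
  have hq1 : 1 ≤ ENNReal.ofReal q := by
    rw [← ENNReal.ofReal_one]
    exact ENNReal.ofReal_le_ofReal (by linarith)
  have hb2 : 0 < b / 2 := ENNReal.half_pos hb.ne'
  obtain ⟨m, hm⟩ : ∃ m : ℕ, C * θ ^ m * ENNReal.ofReal M < b / 2 := by
    have h1 := ENNReal.tendsto_pow_atTop_nhds_zero_of_lt_one hθ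
    have h2 : Tendsto (fun m : ℕ => C * θ ^ m * ENNReal.ofReal M) atTop (𝓝 0) := by
      simpa using ENNReal.Tendsto.mul_const (ENNReal.Tendsto.const_mul h1 (Or.inr hC))
        (Or.inr ENNReal.ofReal_ne_top)
    exact (h2.eventually (gt_mem_nhds hb2)).exists
  set k := a m
  have hk := ha m
  have hkc := hac m
  have hk1 : eLpNorm k 1 volume ≠ ⊤ := (hk.memLp_of_hasCompactSupport hkc).2.ne
  have hk2 : eLpNorm k 2 volume ≠ ⊤ := (hk.memLp_of_hasCompactSupport hkc).2.ne
  obtain ⟨σ, hσ, hσb⟩ := exists_pos_rpow_mul_lt (α := (q - 2) / q)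
    (div_pos (by linarith) hq0)
    (K := (eLpNorm k 1 volume * ENNReal.ofReal M) ^ (2 / q))
    (ENNReal.rpow_ne_top_of_nonneg (by positivity) (ENNReal.mul_ne_top hk1 ENNReal.ofReal_ne_top))
    hb2
  obtain ⟨r, hr, hkr⟩ : ∃ r : ℝ, 0 < r ∧ ∀ z, r < ‖z‖ → k z = 0 := by
    obtain ⟨R, hR⟩ := hkc.isBounded.subset_closedBall (0 : EuclideanSpace ℝ ι)
    refine ⟨max R 1, by positivity, fun z hz => ?_⟩
    by_contra h
    have := hR (subset_tsupport _ h)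
    rw [mem_closedBall_zero_iff] at this
    exact absurd (lt_of_le_of_lt (le_max_left R 1) hz) (not_lt.2 this)
  -- If `|k * u|` exceeds `σ` at `z`, Cauchy–Schwarz on the support of `k (z - ·)` forces `L²` norm
  -- at least `σ / ‖k‖₂` on the ball.
  refine ⟨(σ / eLpNorm k 2 volume) ^ 2, r, ?_, hr, fun u hu huM hbu => ?_⟩
  · exact pos_iff_ne_zero.2 (pow_ne_zero 2 (ENNReal.div_pos hσ.ne' hk2).ne')
  have hmu := (continuous_kconv hk hkc hu.1).aestronglyMeasurable (μ := volume)
  -- Otherwise the average is at most `σ` everywhere, and by interpolation both it and the smoothing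
  -- error have `L^q` norm below `b / 2`.
  obtain ⟨z, hz⟩ : ∃ z, σ < ‖kconv k u z‖ₑ := by
    by_contra! hcon
    have h1 := eLpNorm_le_rpow_mul_rpow hmu hcon hq.le
    have h2 : eLpNorm (kconv k u) 2 volume ≤ eLpNorm k 1 volume * ENNReal.ofReal M :=
      (eLpNorm_kconv_two_le hk hu.1.1).trans (by
        gcongr
        exact hu.eLpNorm_le.trans (ENNReal.ofReal_le_ofReal huM))
    have h3 : eLpNorm (kconv k u) (ENNReal.ofReal q) volume < b / 2 := by
      refine lt_of_le_of_lt (h1.trans ?_) hσb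
      gcongr
    have h4 : eLpNorm (u - kconv k u) (ENNReal.ofReal q) volume < b / 2 := by
      refine lt_of_le_of_lt ((hCu u hu m).trans ?_) hm
      gcongr
    have h5 : eLpNorm u (ENNReal.ofReal q) volume < b := by
      calc eLpNorm u (ENNReal.ofReal q) volume
          = eLpNorm (u - kconv k u + kconv k u) (ENNReal.ofReal q) volume := by
            rw [sub_add_cancel]
        _ ≤ _ := eLpNorm_add_le (hu.1.1.sub hmu) hmu hq1
        _ < b / 2 + b / 2 := ENNReal.add_lt_add h4 h3
        _ = b := ENNReal.add_halves b
    exact absurd hbu (not_le.2 h5)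
  refine ⟨z, ?_⟩
  set u' := (Metric.closedBall z r).indicator u with hu'
  have hloc : kconv k u z = kconv k u' z := by
    refine integral_congr_ae (Eventually.of_forall fun y => ?_)
    by_cases hy : y ∈ Metric.closedBall z r
    · simp [hu', hy]
    · have : k (z - y) = 0 := by
        refine hkr _ ?_
        rw [Metric.mem_closedBall, dist_comm, dist_eq_norm] at hy
        exact not_le.1 hy
      simp [this]
  have hle := enorm_kconv_le_mul hk (u := u') (hu.1.1.indicator measurableSet_closedBall) z
  rw [← hloc] at hle
  have e : ∫⁻ y in Metric.closedBall z r, ‖u y‖ₑ ^ 2 = eLpNorm u' 2 volume ^ 2 := by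
    rw [eLpNorm_two_sq, ← lintegral_indicator measurableSet_closedBall]
    refine lintegral_congr fun y => ?_
    by_cases hy : y ∈ Metric.closedBall z r <;> simp [hu', hy]
  rw [e]
  exact pow_le_pow_left' (ENNReal.div_le_of_le_mul' (hz.le.trans hle)) 2

/-- A bounded weak null sequence in `H¹` tends to zero in `L²` of every finite measure that is
dominated by Lebesgue measure. -/
theorem tendsto_eLpNorm_of_weakL2_zero [Nonempty ι] [FiniteDimensional ℂ V]
    {f : ℕ → EuclideanSpace ℝ ι → V} (hf : ∀ n, MemH1 (f n)) {M : ℝ} (hM : ∀ n, h1Norm (f n) ≤ M)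
    (hw : WeakL2 volume f 0) {μ : Measure (EuclideanSpace ℝ ι)} [IsFiniteMeasure μ]
    (hμ : μ ≤ volume) : Tendsto (fun n => eLpNorm (f n) 2 μ) atTop (𝓝 0) := by
  have : FiniteDimensional ℝ V := FiniteDimensional.complexToReal V
  obtain ⟨a, ha, hac, h⟩ := exists_smoothing_kernels (ι := ι) (V := V)
  obtain ⟨C, θ, hC, hθ, hCu⟩ := h 2 le_rfl (by norm_num)
  rw [show ENNReal.ofReal 2 = 2 by simp] at hCu
  rw [ENNReal.tendsto_nhds_zero]
  intro ε hε
  have hε2 : 0 < ε / 2 := ENNReal.half_pos hε.ne'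
  obtain ⟨m, hm⟩ : ∃ m : ℕ, C * θ ^ m * ENNReal.ofReal M < ε / 2 := by
    have h1 := ENNReal.tendsto_pow_atTop_nhds_zero_of_lt_one hθ
    have h2 : Tendsto (fun m : ℕ => C * θ ^ m * ENNReal.ofReal M) atTop (𝓝 0) := by
      simpa using ENNReal.Tendsto.mul_const (ENNReal.Tendsto.const_mul h1 (Or.inr hC))
        (Or.inr ENNReal.ofReal_ne_top)
    exact (h2.eventually (gt_mem_nhds hε2)).exists
  have hcont : ∀ n, Continuous (kconv (a m) (f n)) := fun n =>
    continuous_kconv (ha m) (hac m) (hf n).1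
  -- At a fixed scale and point, averaging is pairing with a fixed `L²` function, so weak
  -- convergence becomes pointwise convergence; dominated convergence applies as `μ` is finite.
  have hpt : ∀ z, Tendsto (fun n => kconv (a m) (f n) z) atTop (𝓝 0) := by
    intro z
    have := hw.tendsto_integral_smul (fun n => (hf n).1) MemLp.zero
      (memLp_comp_sub_left (ha m) (hac m) z 2)
    simpa [kconv] using this
  set K := eLpNorm (a m) 2 volume * ENNReal.ofReal M
  have hK : K ≠ ⊤ := ENNReal.mul_ne_top ((ha m).memLp_of_hasCompactSupport (hac m)).2.ne
    ENNReal.ofReal_ne_top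
  have hbd : ∀ n z, ‖kconv (a m) (f n) z‖ₑ ≤ K := fun n z =>
    (enorm_kconv_le_mul (ha m) (hf n).1.1 z).trans (mul_le_mul_right
      ((hf n).eLpNorm_le.trans (ENNReal.ofReal_le_ofReal (hM n))) _)
  have hsq : Tendsto (fun n => ∫⁻ z, ‖kconv (a m) (f n) z‖ₑ ^ 2 ∂μ) atTop (𝓝 0) := by
    rw [← lintegral_zero (μ := μ)]
    refine tendsto_lintegral_of_dominated_convergence (fun _ => K ^ 2)
      (fun n => ((hcont n).enorm.measurable.pow_const 2)) (fun n => Eventually.of_forall fun z =>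
        pow_le_pow_left' (hbd n z) 2) ?_ (Eventually.of_forall fun z => ?_)
    · rw [lintegral_const]
      exact ENNReal.mul_ne_top (ENNReal.pow_ne_top hK) (measure_ne_top μ _)
    · have := (ENNReal.continuous_pow 2).tendsto _ |>.comp (hpt z).enorm
      simpa [Function.comp_def] using this
  have hnorm : Tendsto (fun n => eLpNorm (kconv (a m) (f n)) 2 μ) atTop (𝓝 0) := by
    have h1 := (ENNReal.continuous_rpow_const (y := (1 / 2 : ℝ))).tendsto 0 |>.comp hsq
    rw [ENNReal.zero_rpow_of_pos (by norm_num)] at h1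
    refine h1.congr fun n => ?_
    rw [Function.comp_apply, ← eLpNorm_two_sq, ← ENNReal.rpow_natCast, ← ENNReal.rpow_mul]
    norm_num
  filter_upwards [hnorm.eventually (gt_mem_nhds hε2)] with n hn
  have hmeas : AEStronglyMeasurable (f n) μ := (hf n).1.1.mono_measure hμ
  have hmk : AEStronglyMeasurable (kconv (a m) (f n)) μ := (hcont n).aestronglyMeasurable
  calc eLpNorm (f n) 2 μ = eLpNorm (f n - kconv (a m) (f n) + kconv (a m) (f n)) 2 μ := by
        rw [sub_add_cancel]
    _ ≤ _ := eLpNorm_add_le (hmeas.sub hmk) hmk (by norm_num)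
    _ ≤ ε / 2 + ε / 2 := by
        refine add_le_add ((eLpNorm_mono_measure _ hμ).trans ((hCu _ (hf n) m).trans ?_)) hn.le
        refine le_trans ?_ hm.le
        gcongr
        exact hM n
    _ = ε := ENNReal.add_halves ε

/-- A finite measure with the same null sets as Lebesgue measure turns local compactness into almost
everywhere convergence on the whole space, with no diagonal argument over balls. -/
theorem exists_finite_measure_le_volume :
    ∃ μ : Measure (EuclideanSpace ℝ ι), IsFiniteMeasure μ ∧ μ ≤ volume ∧ volume ≪ μ := by
  obtain ⟨g, hg, hgm, hgi⟩ := exists_pos_lintegral_lt_of_sigmaFinite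
    (volume : Measure (EuclideanSpace ℝ ι)) (ε := 1) one_ne_zero
  have hm : Measurable fun z => min (g z : ℝ≥0∞) 1 :=
    hgm.coe_nnreal_ennreal.min measurable_const
  refine ⟨volume.withDensity fun z => min (g z : ℝ≥0∞) 1, ?_, ?_, ?_⟩
  · refine isFiniteMeasure_withDensity (ne_top_of_lt (lt_of_le_of_lt ?_ hgi))
    exact lintegral_mono fun z => min_le_left _ _
  · calc _ ≤ volume.withDensity (1 : EuclideanSpace ℝ ι → ℝ≥0∞) :=
        withDensity_mono (Eventually.of_forall fun z => min_le_right _ _)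
      _ = volume := withDensity_one
  · refine withDensity_absolutelyContinuous' hm.aemeasurable (Eventually.of_forall fun z => ?_)
    have : (0 : ℝ≥0∞) < min (g z : ℝ≥0∞) 1 := lt_min (by simpa using hg z) one_pos
    exact this.ne'

theorem exists_ae_tendsto_subseq [Nonempty ι] [FiniteDimensional ℂ V]
    {f : ℕ → EuclideanSpace ℝ ι → V} (hf : ∀ n, MemH1 (f n)) {M : ℝ} (hM : ∀ n, h1Norm (f n) ≤ M)
    (hw : WeakL2 volume f 0) : ∃ φ : ℕ → ℕ, StrictMono φ ∧
      ∀ᵐ z, Tendsto (fun n => f (φ n) z) atTop (𝓝 0) := by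
  obtain ⟨μ, hμf, hμ, hac⟩ := exists_finite_measure_le_volume (ι := ι)
  have h := tendsto_eLpNorm_of_weakL2_zero hf hM hw hμ
  have h' : TendstoInMeasure μ f atTop (0 : EuclideanSpace ℝ ι → V) :=
    tendstoInMeasure_of_tendsto_eLpNorm (p := 2) two_ne_zero
      (fun n => (hf n).1.1.mono_measure hμ) aestronglyMeasurable_zero (by simpa using h)
  obtain ⟨φ, hφ, hφa⟩ := h'.exists_seq_tendsto_ae
  exact ⟨φ, hφ, hac.ae_le hφa⟩

end Compactness

/-! ### The group action and concentration near the axis. -/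

section Symmetry

variable {n k : ℕ}

/-- The `ℝⁿ`-component of a point of `ℝ^{n+k}`. -/
def fstPart (z : Space n k) : EuclideanSpace ℝ (Fin n) := WithLp.toLp 2 fun i => z (Sum.inl i)

/-- The `ℝᵏ`-component of a point of `ℝ^{n+k}`. -/
def sndPart (z : Space n k) : EuclideanSpace ℝ (Fin k) := WithLp.toLp 2 fun i => z (Sum.inr i)

theorem norm_sq_eq_parts (z : Space n k) : ‖z‖ ^ 2 = ‖fstPart z‖ ^ 2 + ‖sndPart z‖ ^ 2 := by
  simp [EuclideanSpace.real_norm_sq_eq, fstPart, sndPart]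

theorem norm_fstPart_le (z : Space n k) : ‖fstPart z‖ ≤ ‖z‖ := by
  have := norm_sq_eq_parts z
  exact le_of_sq_le_sq (by nlinarith [sq_nonneg ‖sndPart z‖]) (norm_nonneg _)

theorem norm_sub_inY_sndPart (z : Space n k) : ‖z - inY n (sndPart z)‖ = ‖fstPart z‖ := by
  have h1 : fstPart (z - inY n (sndPart z)) = fstPart z := by
    ext i; simp [fstPart, inY]
  have h2 : sndPart (z - inY n (sndPart z)) = 0 := by
    ext i; simp [sndPart, inY]
  have := norm_sq_eq_parts (z - inY n (sndPart z))
  rw [h1, h2] at this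
  rw [← sq_eq_sq₀ (norm_nonneg _) (norm_nonneg _), this]
  simp

theorem act_add (A : Matrix (Fin n) (Fin n) ℝ) (z w : Space n k) :
    act k A (z + w) = act k A z + act k A w := by
  simp [act, Matrix.mulVec_add]

theorem act_smul (A : Matrix (Fin n) (Fin n) ℝ) (c : ℝ) (z : Space n k) :
    act k A (c • z) = c • act k A z := by
  simp [act, Matrix.mulVec_smul]

theorem fstPart_act (A : Matrix (Fin n) (Fin n) ℝ) (z : Space n k) :
    fstPart (act k A z) = WithLp.toLp 2 (A.mulVec (fstPart z)) := by
  ext i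
  simp [fstPart, act, Matrix.fromBlocks_mulVec, Function.comp_def]

theorem sndPart_act (A : Matrix (Fin n) (Fin n) ℝ) (z : Space n k) :
    sndPart (act k A z) = sndPart z := by
  ext i
  simp [sndPart, act, Matrix.fromBlocks_mulVec]

theorem act_inY (A : Matrix (Fin n) (Fin n) ℝ) (y : EuclideanSpace ℝ (Fin k)) :
    act k A (inY n y) = inY n y := by
  ext i
  cases i <;> simp [act, inY, Matrix.fromBlocks_mulVec, Function.comp_def, Pi.zero_def,
    Matrix.mulVec, dotProduct]

theorem norm_toLp_mulVec (A : Matrix.specialOrthogonalGroup (Fin n) ℝ)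
    (x : EuclideanSpace ℝ (Fin n)) :
    ‖WithLp.toLp 2 ((A : Matrix (Fin n) (Fin n) ℝ).mulVec (WithLp.ofLp x))‖ = ‖x‖ := by
  have hA : (A : Matrix (Fin n) (Fin n) ℝ).transpose * A = 1 := by
    have := (Matrix.mem_specialOrthogonalGroup_iff.1 A.2).1
    simpa [Matrix.star_eq_conjTranspose] using (Matrix.mem_orthogonalGroup_iff' _ _).1 this
  have h : ∀ w : EuclideanSpace ℝ (Fin n), ‖w‖ ^ 2 = dotProduct (WithLp.ofLp w) (WithLp.ofLp w) := by
    intro w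
    rw [EuclideanSpace.real_norm_sq_eq]
    simp [dotProduct, sq]
  rw [← sq_eq_sq₀ (norm_nonneg _) (norm_nonneg _), h, h, Matrix.dotProduct_mulVec,
    ← Matrix.mulVec_transpose, Matrix.mulVec_mulVec, hA, Matrix.one_mulVec]

theorem norm_act (A : Matrix.specialOrthogonalGroup (Fin n) ℝ) (z : Space n k) :
    ‖act k (A : Matrix (Fin n) (Fin n) ℝ) z‖ = ‖z‖ := by
  rw [← sq_eq_sq₀ (norm_nonneg _) (norm_nonneg _), norm_sq_eq_parts, norm_sq_eq_parts z,
    fstPart_act, sndPart_act, norm_toLp_mulVec]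

/-- The action of a rotation on `ℝ^{n+k}` as a linear isometry. -/
def actIso (k : ℕ) (A : Matrix.specialOrthogonalGroup (Fin n) ℝ) : Space n k ≃ₗᵢ[ℝ] Space n k :=
  LinearIsometry.toLinearIsometryEquiv
    { toFun := act k (A : Matrix (Fin n) (Fin n) ℝ)
      map_add' := act_add _
      map_smul' := act_smul _
      norm_map' := norm_act A } rfl

theorem coe_actIso (A : Matrix.specialOrthogonalGroup (Fin n) ℝ) :
    ⇑(actIso k A) = act k (A : Matrix (Fin n) (Fin n) ℝ) := rfl

theorem measurePreserving_act (A : Matrix.specialOrthogonalGroup (Fin n) ℝ) :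
    MeasurePreserving (act k (A : Matrix (Fin n) (Fin n) ℝ)) volume volume := by
  rw [← coe_actIso]
  exact (actIso k A).measurePreserving

theorem exists_separated_unit_vectors (hn : 2 ≤ n) (M : ℕ) :
    ∃ (e : Fin M → EuclideanSpace ℝ (Fin n)) (d : ℝ), 0 < d ∧ (∀ i, ‖e i‖ = 1) ∧
      ∀ i j, i ≠ j → d ≤ dist (e i) (e j) := by
  have hrank : 1 < Module.rank ℝ (EuclideanSpace ℝ (Fin n)) := by
    rw [← Module.finrank_eq_rank, finrank_euclideanSpace, Fintype.card_fin]
    exact_mod_cast hn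
  have : Nontrivial (EuclideanSpace ℝ (Fin n)) :=
    (rank_pos_iff_nontrivial (R := ℝ)).1 (zero_lt_one.trans hrank)
  -- For `n ≥ 2` the sphere is connected with more than one point, hence infinite; for `n = 1` it
  -- has only two points.
  have hinf : (Metric.sphere (0 : EuclideanSpace ℝ (Fin n)) 1).Infinite := by
    refine (isPreconnected_sphere hrank 0 1).infinite_of_nontrivial ?_
    obtain ⟨x, hx⟩ := (NormedSpace.sphere_nonempty (x := (0 : EuclideanSpace ℝ (Fin n)))
      (r := 1)).2 zero_le_one
    refine ⟨x, hx, -x, by simpa using hx, fun h => ?_⟩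
    have h2 : (2 : ℝ) • x = 0 := by
      rw [two_smul, ← eq_neg_iff_add_eq_zero]
      exact h
    have h0 : x = 0 := by simpa using h2
    rw [h0] at hx
    simp at hx
  have := hinf.to_subtype
  let e : Fin M → EuclideanSpace ℝ (Fin n) := fun i =>
    (Infinite.natEmbedding (Metric.sphere (0 : EuclideanSpace ℝ (Fin n)) 1) i : _)
  have he : Function.Injective e := fun i j h =>
    Fin.ext ((Infinite.natEmbedding _).injective (Subtype.ext h))
  have hev : ∀ᶠ d in 𝓝[>] (0 : ℝ), ∀ i j, i ≠ j → d ≤ dist (e i) (e j) := by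
    refine eventually_all.2 fun i => eventually_all.2 fun j => ?_
    by_cases hij : i = j
    · exact Eventually.of_forall fun d h => absurd hij h
    · filter_upwards [nhdsWithin_le_nhds (Iio_mem_nhds (dist_pos.2 (he.ne hij)))] with d hd _
      exact le_of_lt hd
  obtain ⟨d, hd, hd0⟩ := (hev.and self_mem_nhdsWithin).exists
  exact ⟨e, d, hd0, fun i => mem_sphere_zero_iff_norm.1 (Infinite.natEmbedding
    (Metric.sphere (0 : EuclideanSpace ℝ (Fin n)) 1) i).2, hd⟩

/-- Far from the axis, the orbits of a transitive group contain many separated points. -/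
theorem exists_separated_orbit (hn : 2 ≤ n)
    {G : Subgroup (Matrix.specialOrthogonalGroup (Fin n) ℝ)} (hG : TransitiveOnSphere G)
    (M : ℕ) {r : ℝ} (hr : 0 < r) :
    ∃ R : ℝ, ∀ z : Space n k, R < ‖fstPart z‖ → ∃ g : Fin M → G, ∀ i j, i ≠ j →
      2 * r < dist (act k ((g i : Matrix.specialOrthogonalGroup (Fin n) ℝ) : Matrix _ _ ℝ) z)
        (act k ((g j : Matrix.specialOrthogonalGroup (Fin n) ℝ) : Matrix _ _ ℝ) z) := by
  obtain ⟨e, d, hd, he, hsep⟩ := exists_separated_unit_vectors hn M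
  -- The orbit of `z` reaches the points `‖x‖ • e i`, whose mutual distances are at least `‖x‖ d`.
  refine ⟨2 * r / d, fun z hz => ?_⟩
  set x := fstPart z with hx
  have hx0 : 0 < ‖x‖ := lt_of_le_of_lt (by positivity) hz
  have hunit : ‖‖x‖⁻¹ • x‖ = 1 := by
    rw [norm_smul, norm_inv, norm_norm, inv_mul_cancel₀ hx0.ne']
  choose g hgG hg using fun i => hG (‖x‖⁻¹ • x) (e i) hunit (he i)
  refine ⟨fun i => ⟨g i, hgG i⟩, fun i j hij => ?_⟩
  have hf : ∀ i, fstPart (act k (g i : Matrix (Fin n) (Fin n) ℝ) z) = ‖x‖ • e i := by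
    intro i
    rw [fstPart_act, ← hx, ← hg i, WithLp.ofLp_smul, Matrix.mulVec_smul, WithLp.toLp_smul,
      smul_smul, mul_inv_cancel₀ hx0.ne', one_smul]
  have hsub : ∀ a b : Space n k, fstPart (a - b) = fstPart a - fstPart b := fun a b => rfl
  rw [dist_eq_norm]
  refine lt_of_lt_of_le ?_ (norm_fstPart_le _)
  rw [hsub]
  simp only [hf]
  rw [← smul_sub, norm_smul, norm_norm, ← dist_eq_norm]
  rw [div_lt_iff₀ hd] at hz
  exact lt_of_lt_of_le hz (by gcongr; exact hsep i j hij)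

variable {V : Type*} [NormedAddCommGroup V] [InnerProductSpace ℂ V]
variable {G : Subgroup (Matrix.specialOrthogonalGroup (Fin n) ℝ)} {π : G →* (V ≃ₗᵢ[ℂ] V)}

theorem lintegral_closedBall_act {u : Space n k → V} (hu : u ∈ H1pi k π) (g : G) (z : Space n k)
    (r : ℝ) :
    ∫⁻ y in Metric.closedBall
        (act k ((g : Matrix.specialOrthogonalGroup (Fin n) ℝ) : Matrix _ _ ℝ) z) r, ‖u y‖ₑ ^ 2 =
      ∫⁻ y in Metric.closedBall z r, ‖u y‖ₑ ^ 2 := by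
  have hmp := measurePreserving_act (k := k) (g : Matrix.specialOrthogonalGroup (Fin n) ℝ)
  have hemb : MeasurableEmbedding
      (act k ((g : Matrix.specialOrthogonalGroup (Fin n) ℝ) : Matrix (Fin n) (Fin n) ℝ)) := by
    rw [← coe_actIso]
    exact (actIso k (g : Matrix.specialOrthogonalGroup (Fin n)
      ℝ)).toHomeomorph.measurableEmbedding
  rw [← hmp.setLIntegral_comp_preimage_emb hemb]
  have hpre : act k ((g : Matrix.specialOrthogonalGroup (Fin n) ℝ) : Matrix (Fin n) (Fin n) ℝ) ⁻¹'
      Metric.closedBall (act k ((g : Matrix.specialOrthogonalGroup (Fin n) ℝ) :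
        Matrix (Fin n) (Fin n) ℝ) z) r = Metric.closedBall z r := by
    rw [← coe_actIso]
    exact (actIso k (g : Matrix.specialOrthogonalGroup (Fin n) ℝ)).isometry.preimage_closedBall z r
  rw [hpre]
  refine lintegral_congr_ae (ae_restrict_of_ae ?_)
  filter_upwards [hu.2 g] with y hy
  have : ‖π g (u y)‖ₑ = ‖u y‖ₑ := by
    rw [← ofReal_norm, ← ofReal_norm, LinearIsometryEquiv.norm_map]
  simp only [hy, this]

/-- Equivariant functions of bounded mass cannot concentrate far from the axis. -/
theorem exists_concentration_radius (hn : 2 ≤ n) (hG : TransitiveOnSphere G) {c T : ℝ≥0∞}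
    (hc : 0 < c) (hT : T ≠ ⊤) {r : ℝ} (hr : 0 < r) :
    ∃ R : ℝ, ∀ u ∈ H1pi k π, ∫⁻ z, ‖u z‖ₑ ^ 2 ≤ T → ∀ z,
      c ≤ ∫⁻ y in Metric.closedBall z r, ‖u y‖ₑ ^ 2 → ‖fstPart z‖ ≤ R := by
  obtain ⟨M, hM⟩ := ENNReal.exists_nat_mul_gt hc.ne' hT
  obtain ⟨R, hR⟩ := exists_separated_orbit (k := k) hn hG M hr
  -- Beyond `R` there would be `M` disjoint balls of mass at least `c` each, while `M * c > T`.
  refine ⟨R, fun u hu huT z hz => ?_⟩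
  by_contra! hlt
  obtain ⟨g, hg⟩ := hR z hlt
  let B : Fin M → Set (Space n k) := fun i => Metric.closedBall
    (act k ((g i : Matrix.specialOrthogonalGroup (Fin n) ℝ) : Matrix (Fin n) (Fin n) ℝ) z) r
  have hdisj : Pairwise (Function.onFun Disjoint B) := fun i j hij =>
    Metric.closedBall_disjoint_closedBall (by have := hg i j hij; linarith)
  have h1 : ∫⁻ y in ⋃ i, B i, ‖u y‖ₑ ^ 2 = M * ∫⁻ y in Metric.closedBall z r, ‖u y‖ₑ ^ 2 := by
    rw [lintegral_iUnion (fun i => measurableSet_closedBall) hdisj, tsum_fintype]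
    simp only [lintegral_closedBall_act hu]
    simp
  have h2 : (M : ℝ≥0∞) * c ≤ T := by
    refine le_trans ?_ ((h1.symm.trans_le (setLIntegral_le_lintegral _ _)).trans huT)
    gcongr
  exact absurd hM (not_lt.2 h2)

theorem sub_mem_H1pi {u v : Space n k → V} (hu : u ∈ H1pi k π) (hv : v ∈ H1pi k π) :
    u - v ∈ H1pi k π := by
  refine ⟨hu.1.sub hv.1, fun g => ?_⟩
  filter_upwards [hu.2 g, hv.2 g] with z h1 h2
  simp [h1, h2]

theorem const_smul_mem_H1pi {u : Space n k → V} (hu : u ∈ H1pi k π) (c : ℝ) :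
    c • u ∈ H1pi k π := by
  refine ⟨hu.1.const_smul c, fun g => ?_⟩
  filter_upwards [hu.2 g] with z h1
  rw [Pi.smul_apply, Pi.smul_apply, h1, ← Complex.coe_smul, ← Complex.coe_smul, map_smul]

theorem translateY_mem_H1pi {u : Space n k → V} (hu : u ∈ H1pi k π)
    (y : EuclideanSpace ℝ (Fin k)) : translateY y u ∈ H1pi k π := by
  refine ⟨hu.1.comp_add_right (inY n y), fun g => ?_⟩
  have h := (measurePreserving_add_right (volume : Measure (Space n k))
    (inY n y)).quasiMeasurePreserving.ae (hu.2 g)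
  filter_upwards [h] with z hz
  rw [act_add, act_inY] at hz
  exact hz

/-- The action preserves null sets, so convergence holds at `z` and at `gz` for almost every `z`,
and continuity of `π g` passes the identity to the limit. -/
theorem mem_H1pi_of_ae_tendsto {u : ℕ → Space n k → V} {v : Space n k → V}
    (hu : ∀ m, u m ∈ H1pi k π) (hv : MemH1 v)
    (h : ∀ᵐ z, Tendsto (fun m => u m z) atTop (𝓝 (v z))) : v ∈ H1pi k π := by
  refine ⟨hv, fun g => ?_⟩
  have h' := (measurePreserving_act (k := k)
    (g : Matrix.specialOrthogonalGroup (Fin n) ℝ)).quasiMeasurePreserving.ae h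
  have hall : ∀ᵐ z, ∀ m, u m (act k ((g : Matrix.specialOrthogonalGroup (Fin n) ℝ) :
      Matrix (Fin n) (Fin n) ℝ) z) = π g (u m z) := ae_all_iff.2 fun m => (hu m).2 g
  filter_upwards [h, h', hall] with z h1 h2 h3
  simp only [h3] at h2
  exact tendsto_nhds_unique h2 (((π g).continuous.tendsto _).comp h1)

end Symmetry

/-! ### Power integrals: Brezis–Lieb, strict subadditivity, and homogeneity. -/

section PowerIntegrals

/-- Convexity applied to `s + t = m (s/m) + (1 - m) (t/(1 - m))`; the coefficient of `s ^ q` is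
`m^(1 - q)`, which tends to 1 as `m` increases to 1. -/
theorem exists_add_rpow_le {q : ℝ} (hq : 1 ≤ q) {ε : ℝ} (hε : 0 < ε) :
    ∃ C : ℝ, 0 ≤ C ∧ ∀ s t : ℝ, 0 ≤ s → 0 ≤ t → (s + t) ^ q ≤ (1 + ε) * s ^ q + C * t ^ q := by
  have hlim : Tendsto (fun m : ℝ => m * (m⁻¹) ^ q) (𝓝[<] 1) (𝓝 1) := by
    have : ContinuousAt (fun m : ℝ => m * (m⁻¹) ^ q) 1 :=
      continuousAt_id.mul ((continuousAt_inv₀ one_ne_zero).rpow_const (Or.inl (by norm_num)))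
    have h := this.tendsto
    simp only [inv_one, Real.one_rpow, mul_one] at h
    exact h.mono_left nhdsWithin_le_nhds
  have hev0 : ∀ᶠ m : ℝ in 𝓝[<] 1, m < 1 := self_mem_nhdsWithin
  have hev1 : ∀ᶠ m : ℝ in 𝓝[<] 1, 0 < m := nhdsWithin_le_nhds (Ioi_mem_nhds one_pos)
  obtain ⟨m, hm, hm1, hm0⟩ := ((hlim.eventually (gt_mem_nhds (by linarith : (1 : ℝ) < 1 + ε))).and
    (hev0.and hev1)).exists
  have hm0' : 0 < m := hm0
  have hm1' : 0 < 1 - m := sub_pos.2 hm1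
  refine ⟨(1 - m) * ((1 - m)⁻¹) ^ q, by positivity, fun s t hs ht => ?_⟩
  have h := (convexOn_rpow hq).2 (x := m⁻¹ * s) (y := (1 - m)⁻¹ * t)
    (by simp only [Set.mem_Ici]; positivity) (by simp only [Set.mem_Ici]; positivity)
    hm0'.le hm1'.le (by ring)
  simp only [smul_eq_mul] at h
  rw [mul_inv_cancel_left₀ hm0'.ne', mul_inv_cancel_left₀ hm1'.ne',
    Real.mul_rpow (by positivity) hs, Real.mul_rpow (by positivity) ht, ← mul_assoc,
    ← mul_assoc] at h
  refine h.trans ?_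
  gcongr

/-- A one-sided Brezis–Lieb inequality. -/
theorem eventually_integral_norm_rpow_add_le {X : Type*} [MeasurableSpace X] {μ : Measure X}
    {W : Type*} [NormedAddCommGroup W] {q : ℝ} (hq : 1 ≤ q) {f : ℕ → X → W} {v : X → W}
    (hf : ∀ n, MemLp (f n) (ENNReal.ofReal q) μ) (hv : MemLp v (ENNReal.ofReal q) μ)
    (hlim : ∀ᵐ x ∂μ, Tendsto (fun n => f n x) atTop (𝓝 0)) {ε : ℝ} (hε : 0 < ε) :
    ∀ᶠ n in atTop, ∫ x, ‖f n x + v x‖ ^ q ∂μ ≤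
      (1 + ε) * (∫ x, ‖f n x‖ ^ q ∂μ) + (∫ x, ‖v x‖ ^ q ∂μ) + ε := by
  have hq0 : 0 < q := by linarith
  have hint : ∀ g : X → W, MemLp g (ENNReal.ofReal q) μ → Integrable (fun x => ‖g x‖ ^ q) μ := by
    intro g hg
    have := hg.integrable_norm_rpow (by simpa using hq0) (by simp)
    rwa [ENNReal.toReal_ofReal hq0.le] at this
  have if' := fun n => hint _ (hf n)
  have iv := hint _ hv
  have ifv : ∀ n, Integrable (fun x => ‖f n x + v x‖ ^ q) μ := fun n => hint _ ((hf n).add hv)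
  obtain ⟨C, hC, hCst⟩ := exists_add_rpow_le hq hε
  -- The positive part of the defect. It tends to zero almost everywhere and is dominated by `C
  -- ‖v‖^q`; the term `ε ‖f n‖^q` absorbs what could not be dominated.
  let D : ℕ → X → ℝ := fun n x =>
    max 0 (‖f n x + v x‖ ^ q - (1 + ε) * ‖f n x‖ ^ q - ‖v x‖ ^ q)
  have iD0 : ∀ n, Integrable (fun x => ‖f n x + v x‖ ^ q - (1 + ε) * ‖f n x‖ ^ q - ‖v x‖ ^ q) μ :=
    fun n => ((ifv n).sub ((if' n).const_mul _)).sub iv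
  have iD : ∀ n, Integrable (D n) μ := fun n => (integrable_zero X ℝ μ).sup (iD0 n)
  have hD : Tendsto (fun n => ∫ x, D n x ∂μ) atTop (𝓝 0) := by
    rw [← integral_zero X ℝ (μ := μ)]
    refine tendsto_integral_of_dominated_convergence (fun x => C * ‖v x‖ ^ q)
      (fun n => (iD n).1) (iv.const_mul C) (fun n => Eventually.of_forall fun x => ?_) ?_
    · rw [Real.norm_eq_abs, abs_of_nonneg (le_max_left _ _)]
      refine max_le (by positivity) ?_
      have h1 : ‖f n x + v x‖ ^ q ≤ (‖f n x‖ + ‖v x‖) ^ q :=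
        Real.rpow_le_rpow (norm_nonneg _) (norm_add_le _ _) hq0.le
      have h2 := hCst ‖f n x‖ ‖v x‖ (norm_nonneg _) (norm_nonneg _)
      have h3 : 0 ≤ ‖v x‖ ^ q := by positivity
      linarith
    · filter_upwards [hlim] with x hx
      have t1 : Tendsto (fun n => ‖f n x + v x‖ ^ q) atTop (𝓝 (‖v x‖ ^ q)) := by
        have := (hx.add_const (v x)).norm.rpow_const (p := q) (Or.inr hq0.le)
        simpa using this
      have t2 : Tendsto (fun n => ‖f n x‖ ^ q) atTop (𝓝 0) := by
        have := hx.norm.rpow_const (p := q) (Or.inr hq0.le)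
        simpa [Real.zero_rpow hq0.ne'] using this
      have t3 := (tendsto_const_nhds (x := (0 : ℝ))).max
        ((t1.sub (t2.const_mul (1 + ε))).sub_const (‖v x‖ ^ q))
      simpa [D] using t3
  filter_upwards [hD.eventually (gt_mem_nhds hε)] with n hn
  have hle : ∫ x, ‖f n x + v x‖ ^ q ∂μ ≤
      ∫ x, ((1 + ε) * ‖f n x‖ ^ q + ‖v x‖ ^ q + D n x) ∂μ := by
    refine integral_mono (ifv n) ((((if' n).const_mul _).add iv).add (iD n)) fun x => ?_
    have : _ ≤ D n x := le_max_right _ _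
    simp only []
    linarith
  have heq : ∫ x, ((1 + ε) * ‖f n x‖ ^ q + ‖v x‖ ^ q + D n x) ∂μ =
      (1 + ε) * (∫ x, ‖f n x‖ ^ q ∂μ) + (∫ x, ‖v x‖ ^ q ∂μ) + ∫ x, D n x ∂μ := by
    rw [← integral_const_mul, ← integral_add ((if' n).const_mul _) iv]
    exact integral_add (((if' n).const_mul _).add iv) (iD n)
  linarith

/-- On `(0, 1)` one has `x < x ^ θ`, and the two fractions add up to 1. -/
theorem rpow_lt_rpow_add_rpow_sub {a b θ : ℝ} (ha : 0 < a) (hab : a < b) (hθ : θ < 1) :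
    1 < (a / b) ^ θ + ((b - a) / b) ^ θ := by
  have hb : 0 < b := ha.trans hab
  have h1 : a / b < (a / b) ^ θ := by
    have := Real.rpow_lt_rpow_of_exponent_gt (x := a / b) (by positivity)
      ((div_lt_one hb).2 hab) hθ
    rwa [Real.rpow_one] at this
  have h2 : (b - a) / b < ((b - a) / b) ^ θ := by
    have := Real.rpow_lt_rpow_of_exponent_gt (x := (b - a) / b)
      (div_pos (by linarith) hb) ((div_lt_one hb).2 (by linarith)) hθ
    rwa [Real.rpow_one] at this
  have h3 : a / b + (b - a) / b = 1 := by field_simp; ring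
  linarith

variable {ι : Type*} [Fintype ι] [DecidableEq ι]
variable {V : Type*} [NormedAddCommGroup V] [InnerProductSpace ℂ V]

theorem J_nonneg {p : ℝ} {u : EuclideanSpace ℝ ι → V} : 0 ≤ J p u :=
  integral_nonneg fun _ => by positivity

theorem eLpNorm_eq_ofReal_J_rpow {p : ℝ} (hp : 1 < p) {u : EuclideanSpace ℝ ι → V}
    (hu : MemLp u (ENNReal.ofReal (p + 1)) volume) :
    eLpNorm u (ENNReal.ofReal (p + 1)) volume = ENNReal.ofReal (J p u ^ (p + 1)⁻¹) := by
  have h := hu.eLpNorm_eq_integral_rpow_norm (by simp; linarith) (by simp)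
  rwa [ENNReal.toReal_ofReal (by linarith)] at h

theorem MemH1.memLp_of_subcritical [Nonempty ι] [FiniteDimensional ℂ V] {q : ℝ} (hq : 2 ≤ q)
    (hqN : Fintype.card ι * (q - 2) < 2 * q) {u : EuclideanSpace ℝ ι → V} (hu : MemH1 u) :
    MemLp u (ENNReal.ofReal q) volume := by
  obtain ⟨C, hC, h⟩ := exists_sobolev_const (ι := ι) (V := V) hq hqN
  exact ⟨hu.1.1, lt_of_le_of_lt (h u hu) (ENNReal.mul_lt_top hC.lt_top ENNReal.ofReal_lt_top)⟩

theorem exists_J_rpow_le [Nonempty ι] [FiniteDimensional ℂ V] {p : ℝ} (hp : 1 < p)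
    (hpN : Fintype.card ι * ((p + 1) - 2) < 2 * (p + 1)) {lam : ℝ} (hlam : 0 < lam) :
    ∃ C : ℝ, 0 < C ∧ ∀ u : EuclideanSpace ℝ ι → V, MemH1 u →
      J p u ^ (2 / (p + 1)) ≤ C * F lam u := by
  obtain ⟨C, hC, h⟩ := exists_sobolev_const (ι := ι) (V := V) (by linarith : 2 ≤ p + 1) hpN
  refine ⟨(C.toReal ^ 2 + 1) * (1 + lam⁻¹), by positivity, fun u hu => ?_⟩
  have h1 := h u hu
  have hF : 0 ≤ F 1 u := F_nonneg zero_le_one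
  rw [eLpNorm_eq_ofReal_J_rpow hp (hu.memLp_of_subcritical (by linarith) hpN),
    ← ENNReal.ofReal_toReal hC, ← ENNReal.ofReal_mul ENNReal.toReal_nonneg,
    h1Norm_eq_sqrt_F, ENNReal.ofReal_le_ofReal_iff
      (mul_nonneg ENNReal.toReal_nonneg (Real.sqrt_nonneg _))] at h1
  have h2 : J p u ^ (2 / (p + 1)) = (J p u ^ (p + 1)⁻¹) ^ 2 := by
    rw [← Real.rpow_natCast, ← Real.rpow_mul J_nonneg]
    congr 1
    push_cast
    ring
  have h3 : (J p u ^ (p + 1)⁻¹) ^ 2 ≤ (C.toReal * Real.sqrt (F 1 u)) ^ 2 :=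
    pow_le_pow_left₀ (Real.rpow_nonneg J_nonneg _) h1 2
  rw [h2]
  refine h3.trans ?_
  rw [mul_pow, Real.sq_sqrt hF, mul_assoc]
  have h4 := F_one_le (u := u) hlam
  have h5 : 0 ≤ C.toReal ^ 2 := by positivity
  nlinarith

theorem J_const_smul {p : ℝ} (u : EuclideanSpace ℝ ι → V) {c : ℝ} (hc : 0 ≤ c) :
    J p (c • u) = c ^ (p + 1) * J p u := by
  rw [J, J, ← integral_const_mul]
  refine integral_congr_ae (Eventually.of_forall fun z => ?_)
  simp only [Pi.smul_apply]
  rw [norm_smul, Real.norm_of_nonneg hc, Real.mul_rpow hc (norm_nonneg _)]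

theorem J_pos_of_not_ae_zero {p : ℝ} (hp : 1 < p) {u : EuclideanSpace ℝ ι → V}
    (hu : MemLp u (ENNReal.ofReal (p + 1)) volume) (h : ¬ u =ᵐ[volume] 0) : 0 < J p u := by
  refine lt_of_le_of_ne J_nonneg fun h0 => h ?_
  have h1 := eLpNorm_eq_ofReal_J_rpow hp hu
  rw [← h0, Real.zero_rpow (by positivity), ENNReal.ofReal_zero] at h1
  exact (eLpNorm_eq_zero_iff hu.1 (by simp; linarith)).1 h1

end PowerIntegrals

/-! ### Scaling and positivity of the constrained infimum. -/

section Infimum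

variable {n k : ℕ} {V : Type*} [NormedAddCommGroup V] [InnerProductSpace ℂ V]
variable {G : Subgroup (Matrix.specialOrthogonalGroup (Fin n) ℝ)} {π : G →* (V ≃ₗᵢ[ℂ] V)}

theorem infF_le {lam p β : ℝ} (hlam : 0 < lam) {u : Space n k → V} (hu : u ∈ H1pi k π)
    (hJ : J p u = β) : infF k π lam p β ≤ F lam u := by
  refine csInf_le ⟨0, ?_⟩ ⟨u, ⟨hu, hJ⟩, rfl⟩
  rintro _ ⟨w, -, rfl⟩
  exact F_nonneg hlam.le

/-- `F` is homogeneous of degree 2 and `J` of degree `p + 1`, so the multiple of `u` satisfying the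
constraint is compared with the infimum. When `J p u = 0` the left side is zero. -/
theorem infF_mul_le [CompleteSpace V] {lam p β : ℝ} (hlam : 0 < lam) (hp : 1 < p) (hβ : 0 < β)
    {u : Space n k → V} (hu : u ∈ H1pi k π) :
    infF k π lam p β * (J p u / β) ^ (2 / (p + 1)) ≤ F lam u := by
  have hF : 0 ≤ F lam u := F_nonneg hlam.le
  rcases (J_nonneg (p := p) (u := u)).eq_or_lt with h0 | hpos
  · rw [← h0, zero_div, Real.zero_rpow (by positivity), mul_zero]
    exact hF
  · set c := (β / J p u) ^ (p + 1)⁻¹ with hc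
    have hc0 : 0 ≤ c := by positivity
    have hJc : J p (c • u) = β := by
      rw [J_const_smul u hc0, hc, ← Real.rpow_mul (by positivity), inv_mul_cancel₀ (by linarith),
        Real.rpow_one]
      field_simp
    have h1 := infF_le hlam (const_smul_mem_H1pi hu c) hJc
    rw [F_const_smul hu.1] at h1
    have hcc : c ^ 2 * (J p u / β) ^ (2 / (p + 1)) = 1 := by
      have e : c ^ 2 = (β / J p u) ^ (2 / (p + 1)) := by
        rw [hc, ← Real.rpow_natCast, ← Real.rpow_mul (by positivity)]
        congr 1
        push_cast
        ring
      rw [e, ← Real.mul_rpow (by positivity) (by positivity)]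
      have : β / J p u * (J p u / β) = 1 := by field_simp
      rw [this, Real.one_rpow]
    calc infF k π lam p β * (J p u / β) ^ (2 / (p + 1))
        ≤ c ^ 2 * F lam u * (J p u / β) ^ (2 / (p + 1)) := by gcongr
      _ = (c ^ 2 * (J p u / β) ^ (2 / (p + 1))) * F lam u := by ring
      _ = F lam u := by rw [hcc, one_mul]

theorem infF_pos [Nonempty (Fin n ⊕ Fin k)] [FiniteDimensional ℂ V] {lam p β : ℝ} (hlam : 0 < lam)
    (hp : 1 < p) (hpN : Fintype.card (Fin n ⊕ Fin k) * ((p + 1) - 2) < 2 * (p + 1)) (hβ : 0 < β)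
    {u : Space n k → V} (hu : u ∈ H1pi k π) (hJ : J p u = β) : 0 < infF k π lam p β := by
  obtain ⟨C, hC, h⟩ := exists_J_rpow_le (ι := Fin n ⊕ Fin k) (V := V) hp hpN hlam
  have hpos : 0 < β ^ (2 / (p + 1)) / C := by positivity
  -- The given `u` makes the constraint set nonempty, without which `sInf` would take its default
  -- value 0.
  refine hpos.trans_le (le_csInf ⟨_, u, ⟨hu, hJ⟩, rfl⟩ ?_)
  rintro _ ⟨w, ⟨hw, hwJ⟩, rfl⟩
  rw [div_le_iff₀ hC, mul_comm, ← hwJ]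
  exact h w hw.1

end Infimum

/-! ### Compactness of minimizing sequences. -/

section Minimizers

attribute [local instance] InnerProductSpace.complexToReal

variable {n k : ℕ} {V : Type*} [NormedAddCommGroup V] [InnerProductSpace ℂ V]
variable {G : Subgroup (Matrix.specialOrthogonalGroup (Fin n) ℝ)} {π : G →* (V ≃ₗᵢ[ℂ] V)}

/-- After translation along `ℝᵏ`, a bounded equivariant sequence whose subcritical norm is bounded
below keeps a fixed amount of mass in a fixed ball. -/
theorem exists_translations_ball_mass [Nonempty (Fin n ⊕ Fin k)] [FiniteDimensional ℂ V]
    (hn : 2 ≤ n) (hG : TransitiveOnSphere G) {p : ℝ} (hp : 1 < p)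
    (hpN : Fintype.card (Fin n ⊕ Fin k) * ((p + 1) - 2) < 2 * (p + 1)) {β : ℝ} (hβ : 0 < β)
    {u : ℕ → Space n k → V} (hu : ∀ m, u m ∈ H1pi k π) {M : ℝ} (hM : ∀ m, h1Norm (u m) ≤ M)
    (hJ : ∀ m, J p (u m) = β) :
    ∃ (y : ℕ → EuclideanSpace ℝ (Fin k)) (c : ℝ≥0∞) (R : ℝ), 0 < c ∧
      ∀ m, c ≤ ∫⁻ z in Metric.closedBall 0 R, ‖translateY (y m) (u m) z‖ₑ ^ 2 := by
  obtain ⟨c, r, hc, hr, hcr⟩ := exists_ball_mass (ι := Fin n ⊕ Fin k) (V := V)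
    (by linarith : 2 < p + 1) hpN M (b := ENNReal.ofReal (β ^ (p + 1)⁻¹))
    (ENNReal.ofReal_pos.2 (by positivity))
  choose z hz using fun m => hcr (u m) (hu m).1 (hM m) (by
    rw [eLpNorm_eq_ofReal_J_rpow hp ((hu m).1.memLp_of_subcritical (by linarith) hpN), hJ])
  obtain ⟨R, hR⟩ := exists_concentration_radius (k := k) (π := π) hn hG hc
    (T := ENNReal.ofReal M ^ 2) (ENNReal.pow_ne_top ENNReal.ofReal_ne_top) hr
  have hzR : ∀ m, ‖fstPart (z m)‖ ≤ R := fun m => hR (u m) (hu m) (by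
    rw [← eLpNorm_two_sq]
    exact pow_le_pow_left' ((hu m).1.eLpNorm_le.trans (ENNReal.ofReal_le_ofReal (hM m))) 2) _ (hz m)
  -- Removing the `ℝᵏ`-component of the centre leaves a point within `R` of the origin, so the ball
  -- of radius `r` about it lies in the ball of radius `R + r`.
  refine ⟨fun m => sndPart (z m), c, R + r, hc, fun m => (hz m).trans ?_⟩
  set a : Space n k := inY n (sndPart (z m)) with ha
  have hmp := measurePreserving_add_right (volume : Measure (Space n k)) a
  have hpre : (fun x : Space n k => x + a) ⁻¹' Metric.closedBall (z m) r ⊆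
      Metric.closedBall 0 (R + r) := by
    intro x hx
    rw [Set.mem_preimage, Metric.mem_closedBall, dist_eq_norm] at hx
    rw [mem_closedBall_zero_iff]
    have h1 : ‖z m - a‖ ≤ R := (norm_sub_inY_sndPart (z m)).trans_le (hzR m)
    calc ‖x‖ = ‖(x + a - z m) + (z m - a)‖ := by congr 1; abel
      _ ≤ ‖x + a - z m‖ + ‖z m - a‖ := norm_add_le _ _
      _ ≤ R + r := by linarith
  rw [← hmp.setLIntegral_comp_preimage_emb (Homeomorph.addRight a).measurableEmbedding]
  exact lintegral_mono_set hpre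

theorem not_ae_zero_of_ball_mass {f : ℕ → Space n k → V} {v : Space n k → V} {c : ℝ≥0∞} (hc : 0 < c)
    {R : ℝ} (hmass : ∀ m, c ≤ ∫⁻ z in Metric.closedBall 0 R, ‖f m z‖ₑ ^ 2)
    (h : Tendsto (fun m => eLpNorm (f m - v) 2 (volume.restrict (Metric.closedBall 0 R))) atTop
      (𝓝 0)) : ¬ v =ᵐ[volume] 0 := by
  intro hv
  have h1 : Tendsto (fun m => eLpNorm (f m - v) 2 (volume.restrict (Metric.closedBall 0 R)) ^ 2)
      atTop (𝓝 0) := by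
    have := (ENNReal.continuous_pow 2).tendsto _ |>.comp h
    simpa [Function.comp_def] using this
  refine absurd (ge_of_tendsto' h1 fun m => ?_) (not_le.2 hc)
  refine (hmass m).trans_eq ?_
  rw [eLpNorm_two_sq]
  refine lintegral_congr_ae (ae_restrict_of_ae ?_)
  filter_upwards [hv] with z hz
  simp [hz]

/-- Strict subadditivity of the constrained infimum: along a nonzero weak limit no part of the
constraint is lost, and the remainders lose all their energy. -/
theorem no_dichotomy [Nonempty (Fin n ⊕ Fin k)] [FiniteDimensional ℂ V]
    {lam p β : ℝ} (hlam : 0 < lam) (hp : 1 < p)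
    (hpN : Fintype.card (Fin n ⊕ Fin k) * ((p + 1) - 2) < 2 * (p + 1)) (hβ : 0 < β)
    {f : ℕ → Space n k → V} {v : Space n k → V} (hf : ∀ m, f m ∈ H1pi k π) (hv : v ∈ H1pi k π)
    (hv0 : ¬ v =ᵐ[volume] 0) (hJ : ∀ m, J p (f m + v) = β)
    (hlim : ∀ᵐ z, Tendsto (fun m => f m z) atTop (𝓝 0)) (hI : 0 < infF k π lam p β)
    (hF : Tendsto (fun m => F lam (f m)) atTop (𝓝 (infF k π lam p β - F lam v))) :
    J p v = β ∧ F lam v = infF k π lam p β := by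
  have : CompleteSpace V := FiniteDimensional.complete ℂ V
  have hmem : ∀ w ∈ H1pi k π, MemLp w (ENNReal.ofReal (p + 1)) volume := fun w hw =>
    hw.1.memLp_of_subcritical (by linarith) hpN
  set I := infF k π lam p β
  set θ := 2 / (p + 1) with hθ
  have hθ0 : 0 < θ := by positivity
  have hθ1 : θ < 1 := by rw [hθ, div_lt_one (by linarith)]; linarith
  have ha : 0 < J p v := J_pos_of_not_ae_zero hp (hmem v hv) hv0
  have hFv : I * (J p v / β) ^ θ ≤ F lam v := infF_mul_le hlam hp hβ hv
  have hge : β ≤ J p v := by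
    by_contra! hlt
    have hc : ∀ c : ℝ, 0 ≤ c → c < β - J p v → I * (c / β) ^ θ ≤ I - F lam v := by
      intro c hc0 hc
      -- Solves `c (1 + ε) + ε = β - J p v`, so that the Brezis–Lieb inequality forces `J p (f m) ≥
      -- c`.
      set ε := (β - J p v - c) / (1 + c) with hε
      have hε0 : 0 < ε := div_pos (by linarith) (by linarith)
      have hεc : c * (1 + ε) + ε = β - J p v := by
        rw [hε]
        field_simp
        ring
      refine ge_of_tendsto hF ?_
      filter_upwards [eventually_integral_norm_rpow_add_le (by linarith : 1 ≤ p + 1)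
        (fun m => hmem _ (hf m)) (hmem v hv) hlim hε0] with m hm
      have hm' : β ≤ (1 + ε) * J p (f m) + J p v + ε := by
        rw [← hJ m]
        exact hm
      have hcb : c ≤ J p (f m) := by
        by_contra! h
        have := mul_lt_mul_of_pos_left h (by linarith : 0 < 1 + ε)
        linarith
      refine le_trans ?_ (infF_mul_le hlam hp hβ (hf m))
      gcongr
    have hlim' : Tendsto (fun c : ℝ => I * (c / β) ^ θ) (𝓝[<] (β - J p v))
        (𝓝 (I * ((β - J p v) / β) ^ θ)) := by
      refine Tendsto.mono_left ?_ nhdsWithin_le_nhds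
      exact ((tendsto_id.div_const β).rpow_const (Or.inr hθ0.le)).const_mul I
    have hev0 : ∀ᶠ c : ℝ in 𝓝[<] (β - J p v), c < β - J p v := self_mem_nhdsWithin
    have hev1 : ∀ᶠ c : ℝ in 𝓝[<] (β - J p v), 0 < c :=
      nhdsWithin_le_nhds (Ioi_mem_nhds (sub_pos.2 hlt))
    have hle : I * ((β - J p v) / β) ^ θ ≤ I - F lam v := by
      refine le_of_tendsto hlim' ?_
      filter_upwards [hev0, hev1] with c h1 h2 using hc c h2.le h1
    -- The two pieces cost at most `F lam v` and `I - F lam v`, together `I`, whereas strict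
    -- subadditivity says they cost more than `I`.
    have hstrict := mul_lt_mul_of_pos_left (rpow_lt_rpow_add_rpow_sub ha hlt hθ1) hI
    rw [mul_add] at hstrict
    linarith
  have hle : F lam v ≤ I := by
    have := ge_of_tendsto' hF fun m => F_nonneg (u := f m) hlam.le
    linarith
  have hone : 1 ≤ (J p v / β) ^ θ := Real.one_le_rpow ((one_le_div hβ).2 hge) hθ0.le
  have hFI : F lam v = I := le_antisymm hle (le_trans (by nlinarith) hFv)
  refine ⟨le_antisymm ?_ hge, hFI⟩
  -- An excess of `J p v` over `β` would raise the scaling lower bound for `F lam v` strictly above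
  -- `I`.
  by_contra! hgt
  have := Real.one_lt_rpow ((one_lt_div hβ).2 hgt) hθ0
  nlinarith

theorem tendsto_h1Norm_zero {f : ℕ → Space n k → V} {lam : ℝ} (hlam : 0 < lam)
    (h : Tendsto (fun m => F lam (f m)) atTop (𝓝 0)) :
    Tendsto (fun m => h1Norm (f m)) atTop (𝓝 0) := by
  have h1 := (h.const_mul (1 + lam⁻¹)).sqrt
  rw [mul_zero, Real.sqrt_zero] at h1
  refine squeeze_zero (fun m => Real.sqrt_nonneg _) (fun m => ?_) h1
  rw [h1Norm_eq_sqrt_F]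
  exact Real.sqrt_le_sqrt (F_one_le hlam)

theorem tendsto_eLpNorm_zero_of_h1Norm [Nonempty (Fin n ⊕ Fin k)] [FiniteDimensional ℂ V]
    {q : ℝ} (hq : 2 ≤ q) (hqN : Fintype.card (Fin n ⊕ Fin k) * (q - 2) < 2 * q)
    {f : ℕ → Space n k → V} (hf : ∀ m, MemH1 (f m))
    (h : Tendsto (fun m => h1Norm (f m)) atTop (𝓝 0)) :
    Tendsto (fun m => eLpNorm (f m) (ENNReal.ofReal q) volume) atTop (𝓝 0) := by
  obtain ⟨C, hC, hCu⟩ := exists_sobolev_const (ι := Fin n ⊕ Fin k) (V := V) hq hqN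
  have h1 : Tendsto (fun m => C * ENNReal.ofReal (h1Norm (f m))) atTop (𝓝 0) := by
    have := ENNReal.Tendsto.const_mul (ENNReal.tendsto_ofReal h) (Or.inr hC)
    simpa using this
  exact tendsto_of_tendsto_of_tendsto_of_le_of_le tendsto_const_nhds h1 (fun m => zero_le)
    fun m => hCu _ (hf m)

theorem exists_minimizer_of_minimizing_seq [Nonempty (Fin n ⊕ Fin k)] [FiniteDimensional ℂ V]
    (hn : 2 ≤ n) (hG : TransitiveOnSphere G) {lam p β : ℝ} (hlam : 0 < lam) (hp : 1 < p)
    (hpN : Fintype.card (Fin n ⊕ Fin k) * ((p + 1) - 2) < 2 * (p + 1)) (hβ : 0 < β)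
    {u : ℕ → Space n k → V} (hu : ∀ m, u m ∈ H1pi k π) (hJ : ∀ m, J p (u m) = β)
    (hF : Tendsto (fun m => F lam (u m)) atTop (𝓝 (infF k π lam p β))) :
    ∃ (s : ℕ → ℕ) (y : ℕ → EuclideanSpace ℝ (Fin k)) (u₀ : Space n k → V),
      StrictMono s ∧ u₀ ∈ H1pi k π ∧
      Tendsto (fun m => eLpNorm (translateY (y m) (u (s m)) - u₀)
        (ENNReal.ofReal (p + 1)) volume) atTop (𝓝 0) ∧
      Tendsto (fun m => h1Norm (translateY (y m) (u (s m)) - u₀)) atTop (𝓝 0) ∧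
      J p u₀ = β ∧ F lam u₀ = infF k π lam p β := by
  have : CompleteSpace V := FiniteDimensional.complete ℂ V
  have : FiniteDimensional ℝ V := FiniteDimensional.complexToReal V
  obtain ⟨B, hB⟩ := hF.bddAbove_range
  have hF1 : ∀ m, F 1 (u m) ≤ (1 + lam⁻¹) * B := fun m =>
    (F_one_le hlam).trans (by gcongr; exact hB ⟨m, rfl⟩)
  obtain ⟨y, c, R, hc, hmass⟩ := exists_translations_ball_mass hn hG hp hpN hβ hu
    (M := Real.sqrt ((1 + lam⁻¹) * B))
    (fun m => by rw [h1Norm_eq_sqrt_F]; exact Real.sqrt_le_sqrt (hF1 m)) hJ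
  set w : ℕ → Space n k → V := fun m => translateY (y m) (u m) with hw
  have hwmem : ∀ m, w m ∈ H1pi k π := fun m => translateY_mem_H1pi (hu m) (y m)
  have hwF : ∀ l m, F l (w m) = F l (u m) := fun l m => F_comp_add_right (hu m).1 l _
  have hwJ : ∀ m, J p (w m) = β := fun m => (J_comp_add_right p _).trans (hJ m)
  obtain ⟨v, φ, hφ, hv, hweak, hsplit⟩ := exists_weak_limit w (fun m => (hwmem m).1)
    ((1 + lam⁻¹) * B) (fun m => (hwF 1 m).trans_le (hF1 m))
  have hfH1 : ∀ m, MemH1 (w (φ m) - v) := fun m => (hwmem _).1.sub hv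
  obtain ⟨b, hb⟩ := (hsplit 1).bddBelow_range
  have hfM : ∀ m, h1Norm (w (φ m) - v) ≤ Real.sqrt ((1 + lam⁻¹) * B - b) := by
    intro m
    rw [h1Norm_eq_sqrt_F]
    refine Real.sqrt_le_sqrt ?_
    have h1 : b ≤ F 1 (w (φ m)) - F 1 (w (φ m) - v) := hb ⟨m, rfl⟩
    have h2 := (hwF 1 (φ m)).trans_le (hF1 (φ m))
    linarith
  have hfweak : WeakL2 volume (fun m => w (φ m) - v) 0 := by
    intro h hh
    have h1 := (hweak h hh).sub_const (∫ z, inner ℝ (v z) (h z))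
    rw [sub_self] at h1
    simp only [Pi.zero_apply, inner_zero_left, integral_zero]
    refine h1.congr fun m => ?_
    rw [← integral_sub (integrable_inner_of_memLp (hwmem _).1.1 hh)
      (integrable_inner_of_memLp hv.1 hh)]
    simp [inner_sub_left]
  have : IsFiniteMeasure (volume.restrict (Metric.closedBall (0 : Space n k) R)) :=
    ⟨by rw [Measure.restrict_apply_univ]; exact measure_closedBall_lt_top⟩
  have hv0 : ¬ v =ᵐ[volume] 0 := not_ae_zero_of_ball_mass hc (fun m => hmass (φ m))
    (tendsto_eLpNorm_of_weakL2_zero hfH1 hfM hfweak Measure.restrict_le_self)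
  obtain ⟨ψ, hψ, hae⟩ := exists_ae_tendsto_subseq hfH1 hfM hfweak
  have hvmem : v ∈ H1pi k π := by
    refine mem_H1pi_of_ae_tendsto (fun m => hwmem (φ (ψ m))) hv ?_
    filter_upwards [hae] with z hz
    simpa using hz.add_const (v z)
  have hFf : Tendsto (fun m => F lam (w (φ (ψ m)) - v)) atTop
      (𝓝 (infF k π lam p β - F lam v)) := by
    have h1 := (hF.comp hφ.tendsto_atTop).sub (hsplit lam)
    refine (h1.comp hψ.tendsto_atTop).congr fun m => ?_
    simp [hwF]
  obtain ⟨hJv, hFv⟩ := no_dichotomy hlam hp hpN hβ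
    (fun m => sub_mem_H1pi (hwmem (φ (ψ m))) hvmem) hvmem hv0
    (fun m => by rw [sub_add_cancel]; exact hwJ _) hae
    (infF_pos hlam hp hpN hβ (hu 0) (hJ 0)) hFf
  -- The limit has all the energy, so the remainders have none left: weak convergence has become
  -- strong.
  rw [hFv, sub_self] at hFf
  have hnorm := tendsto_h1Norm_zero hlam hFf
  exact ⟨fun m => φ (ψ m), fun m => y (φ (ψ m)), v, hφ.comp hψ, hvmem,
    tendsto_eLpNorm_zero_of_h1Norm (by linarith) hpN (fun m => hfH1 (ψ m)) hnorm, hnorm, hJv, hFv⟩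

end Minimizers

end AxialVortex

end

theorem proposition3p4 (n k : ℕ) (hn : 2 ≤ n)
    (G : Subgroup (Matrix.specialOrthogonalGroup (Fin n) ℝ))
    (hGclosed : IsClosed (G : Set (Matrix.specialOrthogonalGroup (Fin n) ℝ)))
    (hGtrans : AxialVortex.TransitiveOnSphere G)
    {V : Type*} [NormedAddCommGroup V] [InnerProductSpace ℂ V] [FiniteDimensional ℂ V]
    (π : G →* (V ≃ₗᵢ[ℂ] V)) (hπ : ∀ v : V, Continuous fun g : G => π g v)
    (p lam β : ℝ) (hp : 1 < p)
    (hp' : 2 < n + k → p < ((n : ℝ) + k + 2) / ((n : ℝ) + k - 2))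
    (hlam : 0 < lam) (hβ : 0 < β)
    (u : ℕ → AxialVortex.Space n k → V)
    (hu : ∀ ν, u ν ∈ AxialVortex.H1pi k π)
    (hJ : ∀ ν, AxialVortex.J p (u ν) = β)
    (hF : Tendsto (fun ν => AxialVortex.F lam (u ν)) atTop
      (𝓝 (AxialVortex.infF k π lam p β))) :
    ∃ (s : ℕ → ℕ) (y : ℕ → EuclideanSpace ℝ (Fin k)) (u₀ : AxialVortex.Space n k → V),
      StrictMono s ∧
      u₀ ∈ AxialVortex.H1pi k π ∧
      Tendsto (fun ν => eLpNorm (AxialVortex.translateY (y ν) (u (s ν)) - u₀)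
        (ENNReal.ofReal (p + 1)) volume) atTop (𝓝 0) ∧
      Tendsto (fun ν => AxialVortex.h1Norm (AxialVortex.translateY (y ν) (u (s ν)) - u₀))
        atTop (𝓝 0) ∧
      AxialVortex.J p u₀ = β ∧
      AxialVortex.F lam u₀ = AxialVortex.infF k π lam p β := by
  have : Nonempty (Fin n ⊕ Fin k) := ⟨Sum.inl ⟨0, by omega⟩⟩
  -- Subcriticality of `q = p + 1` written without division, `N (q - 2) < 2 q`; this form also
  -- covers `N = 2`, where it holds for every `p`.
  have hpN : (Fintype.card (Fin n ⊕ Fin k) : ℝ) * ((p + 1) - 2) < 2 * (p + 1) := by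
    rw [Fintype.card_sum, Fintype.card_fin, Fintype.card_fin, Nat.cast_add]
    rcases (show 2 ≤ n + k by omega).eq_or_lt with h | h
    · have h' : (n : ℝ) + k = 2 := by exact_mod_cast h.symm
      rw [h']
      linarith
    · have h' : (2 : ℝ) < n + k := by exact_mod_cast h
      have := hp' h
      rw [lt_div_iff₀ (by linarith)] at this
      nlinarith
  exact AxialVortex.exists_minimizer_of_minimizing_seq hn hGtrans hlam hp hpN hβ hu hJ hF
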